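/- Let $M=[l,r]$ with $l<r$, or $M=\mathbf T=\mathbf R/\mathbf Z$; put $\partial M=\{l,r\}$ in the first case and $\partial M=\emptyset$ in the second. Let $F\in C(\mathbf R)$ be nonnegative with $F(v)=0$ if and only if $v=1$ (F1), and $\liminf_{|v|\to\infty}F(v)>0$ (F2). Let $a\in M\setminus\partial M$ and $b\ge 0$. For $\varepsilon>0$ and $v\in H^1(M)\subset C(M)$ set \[ E^\varepsilon_{\mathrm{sMM},b}(v)=\frac{\varepsilon}{2}\int_M\Bigl|\frac{dv}{dx}\Bigr|^2dx+\frac1{2\varepsilon}\int_M F(v)\,dx+b\,v(a)^2,\qquad G(v)=\Bigl|\int_1^v\sqrt{F(\tau)}\,d\tau\Bigr| . \] Let $\mathcal B$ be the set of set-valued functions $\Gamma$ on $M$, with values subsets of $\mathbf R$, whose graph $\{(x,y): x\in M,\ y\in\Gamma(x)\}$ is compact in $M\times\mathbf R$. Let $\mathcal A_0$ be the set of $\Gamma\in\mathcal B$ such that every $\Gamma(x)$ is a nonempty closed interval and $\Gamma(x)=\{1\}$ for all but countably many $x$. For $v_\varepsilon\in C(M)$ and $\Xi\in\mathcal B$ write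 $v_\varepsilon\xrightarrow{g}\Xi$ if the graph of $v_\varepsilon$ converges to the graph of $\Xi$ in the Hausdorff distance of $M\times\mathbf R$ as $\varepsilon\downarrow0$. For $\Xi\in\mathcal A_0$ let $\Sigma$ be the (countable) set of points $x_i$ at which $\Xi(x_i)=[\xi_i^-,\xi_i^+]$ with $\xi_i^-<\xi_i^+$, let $\kappa_i=1$ if $x_i\in\partial M$ and $\kappa_i=0$ otherwise, and set \[ E^0_{\mathrm{sMM}}(\Xi,M)=\sum_{x_i\in\Sigma}\Bigl\{2\bigl(G(\xi_i^-)+G(\xi_i^+)\bigr)-\kappa_i\max\bigl(G(\xi_i^-),G(\xi_i^+)\bigr)\Bigr\}\in[0,\infty]; \] set $E^0_{\mathrm{sMM}}(\Xi,M)=\infty$ for $\Xi\in\mathcal B\setminus\mathcal A_0$. Let $E^0_{\mathrm{sMM},b}(\Xi,M)=E^0_{\mathrm{sMM}}(\Xi,M)+b\,(\min\Xi(a))^2$. Then: (i) (liminf inequality) Let $v_\varepsilon\in H^1(M)$ for $0<\varepsilon<1$ and $v_\varepsilon\xrightarrow{g}\Xi\in\mathcal B$. If $b=0$ or $\min\Xi(a)\ge0$,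 then \[ E^0_{\mathrm{sMM},b}(\Xi,M)\le\liminf_{\varepsilon\to0}E^\varepsilon_{\mathrm{sMM},b}(v_\varepsilon). \] Moreover (without a sign condition on $\Xi(a)$), if $\liminf_{\varepsilon\to0}E^\varepsilon_{\mathrm{sMM},b}(v_\varepsilon)<\infty$, then $\Xi\in\mathcal A_0$. (ii) (limsup inequality) For every $\Xi\in\mathcal A_0$ there are $w_\varepsilon\in H^1(M)$, $0<\varepsilon<1$, such that $w_\varepsilon\xrightarrow{g}\Xi$ and \[ \lim_{\varepsilon\to0}E^\varepsilon_{\mathrm{sMM},b}(w_\varepsilon)=E^0_{\mathrm{sMM},b}(\Xi,M)\in[0,\infty]. \] -/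

import Mathlib

namespace SMM

open MeasureTheory Filter Topology
open scoped ENNReal

noncomputable section

/-! ### Set-valued functions and graph convergence -/

section SetValued

variable {M : Type*} [MetricSpace M]

/-- The graph of a set-valued function, in `M × ℝ` with the distance
`(d_M(x, x')² + |y - y'|²)^{1/2}`. -/
def graph (Γ : M → Set ℝ) : Set (WithLp 2 (M × ℝ)) :=
  {z | z.snd ∈ Γ z.fst}

/-- The set-valued function `x ↦ {g x}` of a continuous function `g`. -/
def single (g : C(M, ℝ)) : M → Set ℝ := fun x => {g x}

/-- The class `𝓑` of bounded upper semicontinuous set-valued functions. -/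
def classB (M : Type*) [MetricSpace M] : Set (M → Set ℝ) :=
  {Γ | IsCompact (graph Γ)}

/-- The class `𝓐` of those `Γ ∈ 𝓑` all of whose values are (nonempty) closed intervals. -/
def classA (M : Type*) [MetricSpace M] : Set (M → Set ℝ) :=
  {Γ | Γ ∈ classB M ∧ ∀ x, ∃ p q : ℝ, p ≤ q ∧ Γ x = Set.Icc p q}

/-- The class `𝓐₀` of those `Γ ∈ 𝓐` with `Γ x = {1}` for all but countably many `x`. -/
def classA₀ (M : Type*) [MetricSpace M] : Set (M → Set ℝ) :=
  {Γ | Γ ∈ classA M ∧ {x | Γ x ≠ {1}}.Countable}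

/-- Graph convergence `v_ε → Ξ` as `ε ↓ 0`. The Hausdorff distance is taken in `[0, ∞]`,
so that a nonempty graph is at distance `∞` from an empty one. -/
def GraphTendsto (v : ℝ → C(M, ℝ)) (Ξ : M → Set ℝ) : Prop :=
  Tendsto (fun ε => Metric.hausdorffEDist (graph (single (v ε))) (graph Ξ)) (𝓝[>] 0) (𝓝 0)

/-- The set `Σ` of exceptional points: those where the value is a nontrivial interval. -/
def exceptional (Ξ : M → Set ℝ) : Set M := {x | (Ξ x).Nontrivial}

end SetValued

/-! ### The one-dimensional domains -/

/-- The domain `M`: a closed bounded interval `[l, r]` with `l < r`, or the circle `ℝ / ℤ`. -/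
inductive Domain : Type
  | interval (l r : ℝ) (h : l < r) : Domain
  | circle : Domain

namespace Domain

/-- The points of `M`. -/
def Pt : Domain → Type
  | interval l r _ => Set.Icc l r
  | circle => UnitAddCircle

instance instMetricSpace : (D : Domain) → MetricSpace D.Pt
  | interval l r _ => inferInstanceAs (MetricSpace (Set.Icc l r))
  | circle => inferInstanceAs (MetricSpace UnitAddCircle)

/-- Left end of the parameter interval of `M` (`[l, r]`, respectively `[0, 1]`). -/
def left : Domain → ℝ
  | interval l _ _ => l
  | circle => 0

/-- Right end of the parameter interval of `M`. -/
def right : Domain → ℝ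
  | interval _ r _ => r
  | circle => 1

/-- The coordinate `[left, right] → M`: the identity of `[l, r]` (its values outside `[l, r]`
play no role), respectively the quotient map `[0, 1] → ℝ / ℤ`. -/
def param : (D : Domain) → ℝ → D.Pt
  | interval l r h => Set.projIcc l r h.le
  | circle => fun x => (x : UnitAddCircle)

/-- The boundary of `M`: the two end points, respectively empty. -/
def boundary : (D : Domain) → Set D.Pt
  | interval l r _ => {x : Set.Icc l r | (x : ℝ) = l ∨ (x : ℝ) = r}
  | circle => ∅

end Domain

/-! ### The functionals -/

/-- `v ∈ H¹(M)`: in the coordinate of `M`, the continuous function `v` is absolutely continuous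
with square integrable derivative. -/
def MemH1 (D : Domain) (v : C(D.Pt, ℝ)) : Prop :=
  AbsolutelyContinuousOnInterval (fun x => v (D.param x)) D.left D.right ∧
    MemLp (deriv fun x => v (D.param x)) 2 (volume.restrict (Set.Ioo D.left D.right))

/-- The single-well Modica–Mortola functional. -/
def energy (D : Domain) (F : ℝ → ℝ) (ε : ℝ) (v : C(D.Pt, ℝ)) : ℝ :=
  ε / 2 * (∫ x in D.left..D.right, |deriv (fun x => v (D.param x)) x| ^ 2) +
    1 / (2 * ε) * ∫ x in D.left..D.right, F (v (D.param x))

/-- The functional with the additional term `b v(a)²`. -/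
def energyB (D : Domain) (F : ℝ → ℝ) (a : D.Pt) (b ε : ℝ) (v : C(D.Pt, ℝ)) : ℝ :=
  energy D F ε v + b * v a ^ 2

/-- `G(v) = |∫₁ᵛ √F|`. -/
def G (F : ℝ → ℝ) (v : ℝ) : ℝ := |∫ τ in (1 : ℝ)..v, √(F τ)|

/-- `κ = 1` at the boundary points of `M` and `κ = 0` elsewhere. -/
def kappa (D : Domain) : D.Pt → ℝ := D.boundary.indicator 1

open Classical in
/-- The limit functional: a sum over the exceptional points `x`, where
`ξ⁻ = min (Ξ x)` and `ξ⁺ = max (Ξ x)`, if `Ξ ∈ 𝓐₀`, and `∞` otherwise. -/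
def limitEnergy (D : Domain) (F : ℝ → ℝ) (Ξ : D.Pt → Set ℝ) : ℝ≥0∞ :=
  if Ξ ∈ classA₀ D.Pt then
    ∑' x : exceptional Ξ,
      ENNReal.ofReal
        (2 * (G F (sInf (Ξ x)) + G F (sSup (Ξ x))) -
          kappa D x * max (G F (sInf (Ξ x))) (G F (sSup (Ξ x))))
  else ∞

/-- The limit functional with the additional term `b (min Ξ(a))²`. -/
def limitEnergyB (D : Domain) (F : ℝ → ℝ) (a : D.Pt) (b : ℝ) (Ξ : D.Pt → Set ℝ) : ℝ≥0∞ :=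
  limitEnergy D F Ξ + ENNReal.ofReal (b * sInf (Ξ a) ^ 2)

/-- Condition (F1): `F` is continuous, nonnegative, and vanishes exactly at `1`. -/
def CondF1 (F : ℝ → ℝ) : Prop :=
  Continuous F ∧ (∀ v, 0 ≤ F v) ∧ ∀ v, F v = 0 ↔ v = 1

/-- Condition (F2): `liminf_{|v| → ∞} F v > 0`. -/
def CondF2 (F : ℝ → ℝ) : Prop :=
  0 < liminf (fun v => (F v : EReal)) (cocompact ℝ)

end

end SMM

/-! Everything rests on ε/2·|v'|² + F(v)/(2ε) ≥ √F(v)·|v'| = |(P∘v)'|, where P = `primG F` is the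
signed primitive with |P| = G. Hence the energy over a parameter interval dominates the variation of
P∘v there (`ofReal_abs_primG_sub_le_density`).

Lower bound. Graph convergence brings v_ε close to every value of Ξ(x) at points near x, and makes
it converge to 1 wherever Ξ = {1}; for Ξ ∈ 𝓐₀ such points are dense. Near an interior exceptional
point, P∘v_ε therefore runs from about 0 to -G(ξ⁻) and G(ξ⁺), in some order, and back to about 0,
which costs 2(G(ξ⁻) + G(ξ⁺)). At a boundary point only one side is available: the end met closest to
the boundary is paid once, the other twice, and the cheapest order subtracts the maximum
(`eventually_ofReal_jumpCost_le`). Disjoint neighbourhoods of finitely many points add these costs,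
and a supremum over finite sets gives the series (`tsum_add_le_liminf`). If the liminf is finite,
v_ε cannot stay away from 1 on an interval, so 1 ∈ Ξ(x) for all x; the intermediate value theorem
makes the values intervals; every x with Ξ(x) ≠ {1} costs a positive amount, so these x are
countable (`mem_classA₀_of_liminf_lt_top`).

Recovery. Near-equality asks for v' ≈ ±√F(v)/ε. Replacing F by F + δ on a bounded range gives a
profile that leaves 1 at once and reaches any height in finite time, hence bumps of width O(ε)
(`eventually_exists_bumps`). A finite net of the graph of Ξ is followed with two bumps per base
point, one for each end of the interval, the second at a slightly shifted centre; at a boundary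
point the end with larger G sits on the point itself and costs only one side. The bump at a has
height exactly min Ξ(a). A diagonal choice in the accuracy yields one family, and the lower bound
with b = 0 turns the upper bound into a limit (`exists_recovery`). -/

namespace SMM

open MeasureTheory Filter Topology
open scoped ENNReal

/-! ### Pointwise consequences of graph convergence -/

section GraphConvergence

variable {M : Type*} [MetricSpace M]

lemma dist_le_add_of_withLp (z w : WithLp 2 (M × ℝ)) :
    dist z w ≤ dist z.fst w.fst + dist z.snd w.snd := by
  rw [WithLp.prod_dist_eq_add (by norm_num)]
  norm_num
  rw [← Real.sqrt_eq_rpow]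
  apply Real.sqrt_le_iff.mpr
  constructor
  · positivity
  · nlinarith [dist_nonneg (x := z.fst) (y := w.fst), dist_nonneg (x := z.snd) (y := w.snd)]

lemma dist_fst_le_of_withLp (z w : WithLp 2 (M × ℝ)) : dist z.fst w.fst ≤ dist z w := by
  rw [WithLp.prod_dist_eq_add (by norm_num)]
  norm_num
  rw [← Real.sqrt_eq_rpow]
  apply Real.le_sqrt_of_sq_le
  nlinarith [sq_nonneg (dist z.snd w.snd)]

lemma dist_snd_le_of_withLp (z w : WithLp 2 (M × ℝ)) : dist z.snd w.snd ≤ dist z w := by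
  rw [WithLp.prod_dist_eq_add (by norm_num)]
  norm_num
  rw [← Real.sqrt_eq_rpow]
  apply Real.le_sqrt_of_sq_le
  nlinarith [sq_nonneg (dist z.fst w.fst)]

lemma GraphTendsto.eventually_lt {v : ℝ → C(M, ℝ)} {Ξ : M → Set ℝ} (h : GraphTendsto v Ξ)
    {ρ : ℝ} (hρ : 0 < ρ) : ∀ᶠ ε in 𝓝[>] (0 : ℝ),
      Metric.hausdorffEDist (graph (single (v ε))) (graph Ξ) < ENNReal.ofReal ρ :=
  h.eventually_lt_const (ENNReal.ofReal_pos.2 hρ)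

lemma GraphTendsto.eventually_exists_near {v : ℝ → C(M, ℝ)} {Ξ : M → Set ℝ}
    (h : GraphTendsto v Ξ) {x : M} {y : ℝ} (hy : y ∈ Ξ x) {ρ : ℝ} (hρ : 0 < ρ) :
    ∀ᶠ ε in 𝓝[>] (0 : ℝ), ∃ p, dist p x < ρ ∧ |v ε p - y| < ρ := by
  filter_upwards [h.eventually_lt hρ] with ε hε
  rw [Metric.hausdorffEDist_comm] at hε
  obtain ⟨z, hz, hd⟩ := Metric.exists_edist_lt_of_hausdorffEDist_lt
    (x := WithLp.toLp 2 (x, y)) (show _ ∈ graph Ξ from hy) hε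
  rw [edist_dist, ENNReal.ofReal_lt_ofReal_iff hρ, dist_comm] at hd
  have hz' : z.snd = v ε z.fst := hz
  refine ⟨z.fst, (dist_fst_le_of_withLp _ _).trans_lt hd, ?_⟩
  rw [← hz', ← Real.dist_eq]
  exact (dist_snd_le_of_withLp _ _).trans_lt hd

/-- Near every point of the graph of `v ε` there is a point of the graph of the limit. -/
lemma GraphTendsto.eventually_exists_mem {v : ℝ → C(M, ℝ)} {Ξ : M → Set ℝ}
    (h : GraphTendsto v Ξ) {ρ : ℝ} (hρ : 0 < ρ) :
    ∀ᶠ ε in 𝓝[>] (0 : ℝ), ∀ p, ∃ z ∈ graph Ξ, dist (WithLp.toLp 2 (p, v ε p)) z < ρ := by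
  filter_upwards [h.eventually_lt hρ] with ε hε p
  obtain ⟨z, hz, hd⟩ := Metric.exists_edist_lt_of_hausdorffEDist_lt
    (x := WithLp.toLp 2 (p, v ε p)) (show _ ∈ graph (single (v ε)) from rfl) hε
  rw [edist_dist, ENNReal.ofReal_lt_ofReal_iff hρ] at hd
  exact ⟨z, hz, hd⟩

/-- The graph of the limit is closed, and points of the graphs of v_ε are close both to (x, y) and
to it. Having such points only frequently is enough, so a bound along a sequence of ε can be used.
-/
lemma GraphTendsto.mem_of_frequently {v : ℝ → C(M, ℝ)} {Ξ : M → Set ℝ}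
    (h : GraphTendsto v Ξ) (hΞ : Ξ ∈ classB M) {x : M} {y : ℝ}
    (hy : ∀ ρ > 0, ∃ᶠ ε in 𝓝[>] (0 : ℝ), ∃ u, dist u x < ρ ∧ |v ε u - y| < ρ) : y ∈ Ξ x := by
  have hc : IsClosed (graph Ξ) := IsCompact.isClosed hΞ
  suffices WithLp.toLp 2 (x, y) ∈ closure (graph Ξ) by rwa [hc.closure_eq] at this
  rw [Metric.mem_closure_iff]
  intro ρ hρ
  obtain ⟨ε, ⟨u, hu, huy⟩, hε⟩ :=
    ((hy (ρ / 3) (by positivity)).and_eventually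
      (h.eventually_exists_mem (ρ := ρ / 3) (by positivity))).exists
  obtain ⟨z, hz, hd⟩ := hε u
  refine ⟨z, hz, ?_⟩
  have h1 := dist_le_add_of_withLp (WithLp.toLp 2 (x, y)) (WithLp.toLp 2 (u, v ε u))
  have h2 := dist_triangle (WithLp.toLp 2 (x, y)) (WithLp.toLp 2 (u, v ε u)) z
  simp only [WithLp.toLp_fst, WithLp.toLp_snd] at h1
  rw [dist_comm x u, dist_comm y, Real.dist_eq] at h1
  linarith

lemma classB.exists_bound {Ξ : M → Set ℝ} (hΞ : Ξ ∈ classB M) :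
    ∃ R, ∀ x, ∀ y ∈ Ξ x, |y| ≤ R := by
  have hc : Continuous fun z : WithLp 2 (M × ℝ) => z.snd := by fun_prop
  obtain ⟨R, hR⟩ := (IsCompact.image hΞ hc).isBounded.exists_norm_le
  exact ⟨R, fun x y hy => hR y ⟨WithLp.toLp 2 (x, y), hy, rfl⟩⟩

lemma classB.isClosed {Ξ : M → Set ℝ} (hΞ : Ξ ∈ classB M) (x : M) : IsClosed (Ξ x) := by
  have hc : IsClosed (graph Ξ) := IsCompact.isClosed hΞ
  exact hc.preimage (f := fun y : ℝ => WithLp.toLp 2 (x, y)) (by fun_prop)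

lemma classB.isCompact {Ξ : M → Set ℝ} (hΞ : Ξ ∈ classB M) (x : M) : IsCompact (Ξ x) := by
  obtain ⟨R, hR⟩ := classB.exists_bound hΞ
  exact (isCompact_Icc (a := -R) (b := R)).of_isClosed_subset (classB.isClosed hΞ x)
    fun y hy => abs_le.1 (hR x y hy)

lemma GraphTendsto.exists_bound {v : ℝ → C(M, ℝ)} {Ξ : M → Set ℝ}
    (h : GraphTendsto v Ξ) (hΞ : Ξ ∈ classB M) :
    ∃ R, ∀ᶠ ε in 𝓝[>] (0 : ℝ), ∀ x, |v ε x| ≤ R := by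
  obtain ⟨R, hR⟩ := classB.exists_bound hΞ
  refine ⟨R + 1, ?_⟩
  filter_upwards [h.eventually_exists_mem one_pos] with ε hε x
  obtain ⟨z, hz, hd⟩ := hε x
  have h1 := hR z.fst z.snd hz
  have h2 := (dist_snd_le_of_withLp _ _).trans_lt hd
  rw [Real.dist_eq] at h2
  have h3 := abs_sub_abs_le_abs_sub (v ε x) z.snd
  simp only [WithLp.toLp_snd] at h2
  linarith

/-- Otherwise values outside U recur; being bounded they have a cluster point outside U, which lies
in Ξ x. Applied where Ξ x = {1}, this gives pointwise convergence to 1. -/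
lemma GraphTendsto.eventually_mem {v : ℝ → C(M, ℝ)} {Ξ : M → Set ℝ}
    (h : GraphTendsto v Ξ) (hΞ : Ξ ∈ classB M) {x : M} {U : Set ℝ} (hU : IsOpen U)
    (hx : Ξ x ⊆ U) : ∀ᶠ ε in 𝓝[>] (0 : ℝ), v ε x ∈ U := by
  by_contra hcon
  obtain ⟨R, hR⟩ := h.exists_bound hΞ
  have hK : IsCompact (Set.Icc (-R) R \ U) := isCompact_Icc.diff hU
  obtain ⟨y, hy, hyc⟩ := hK.exists_mapClusterPt_of_frequently (l := 𝓝[>] (0 : ℝ))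
    (f := fun ε => v ε x)
    ((not_eventually.1 hcon).and_eventually hR |>.mono fun ε hε => ⟨abs_le.1 (hε.2 x), hε.1⟩)
  refine hy.2 (hx (h.mem_of_frequently hΞ fun ρ hρ => ?_))
  refine (hyc.frequently (Metric.ball_mem_nhds y hρ)).mono fun ε hε => ⟨x, by simpa using hρ, ?_⟩
  simpa [Real.dist_eq] using hε

end GraphConvergence

/-! ### Real parameters for the interval and the circle -/

namespace Domain

/-- The real parameters at which the coordinate of `M` is meaningful. -/
def valid : Domain → Set ℝ
  | interval l r _ => Set.Icc l r
  | circle => Set.univ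

lemma left_lt_right : (D : Domain) → D.left < D.right
  | interval _ _ h => h
  | circle => zero_lt_one

lemma dist_param_le (D : Domain) (s t : ℝ) : dist (D.param s) (D.param t) ≤ |s - t| := by
  cases D with
  | interval l r h =>
    change |(Set.projIcc l r h.le s : ℝ) - Set.projIcc l r h.le t| ≤ |s - t|
    exact Set.abs_projIcc_sub_projIcc h.le
  | circle =>
    change dist (s : UnitAddCircle) (t : UnitAddCircle) ≤ |s - t|
    rw [dist_eq_norm, ← AddCircle.coe_sub, UnitAddCircle.norm_eq]
    simpa using round_le (s - t) 0

lemma lipschitzWith_param (D : Domain) : LipschitzWith 1 D.param :=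
  LipschitzWith.of_dist_le_mul fun s t => by simpa [Real.dist_eq] using D.dist_param_le s t

lemma continuous_param (D : Domain) : Continuous D.param := D.lipschitzWith_param.continuous

lemma ordConnected_valid (D : Domain) : D.valid.OrdConnected := by
  cases D with
  | interval l r h => exact Set.ordConnected_Icc
  | circle => exact Set.ordConnected_univ

lemma Icc_subset_valid (D : Domain) : Set.Icc D.left D.right ⊆ D.valid := by
  cases D with
  | interval l r h => exact subset_rfl
  | circle => exact Set.subset_univ _

/-- On the circle the lift is made closest to s by subtracting the integer nearest to t - s. Points
of M near a given one can then be put in order as real numbers, which the variation estimates need.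
-/
lemma exists_lift (D : Domain) {s : ℝ} (hs : s ∈ D.valid) (y : D.Pt) :
    ∃ t ∈ D.valid, D.param t = y ∧ |t - s| ≤ dist y (D.param s) := by
  cases D with
  | interval l r h =>
    refine ⟨(y : Set.Icc l r).1, (y : Set.Icc l r).2, Set.projIcc_val h.le y, ?_⟩
    change _ ≤ |(y : Set.Icc l r).1 - (Set.projIcc l r h.le s : ℝ)|
    rw [Set.projIcc_of_mem h.le hs]
  | circle =>
    obtain ⟨t, rfl⟩ := QuotientAddGroup.mk_surjective (y : UnitAddCircle)
    refine ⟨t - round (t - s), trivial, ?_, ?_⟩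
    · change ((t - round (t - s) : ℝ) : UnitAddCircle) = (t : UnitAddCircle)
      rw [AddCircle.coe_sub, sub_eq_self]
      simp
    · change _ ≤ dist (t : UnitAddCircle) (s : UnitAddCircle)
      rw [dist_eq_norm, ← AddCircle.coe_sub, UnitAddCircle.norm_eq]
      apply le_of_eq
      congr 1
      ring

lemma exists_rep (D : Domain) (x : D.Pt) : ∃ s ∈ D.valid, D.param s = x := by
  obtain ⟨t, ht, h, -⟩ :=
    D.exists_lift (D.Icc_subset_valid (Set.left_mem_Icc.2 D.left_lt_right.le)) x
  exact ⟨t, ht, h⟩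

end Domain

/-! ### Energy density and periodicity -/

/-- The energy density in the coordinate of `M`, as a function with values in `[0, ∞]`. -/
noncomputable def density (D : Domain) (F : ℝ → ℝ) (ε : ℝ) (v : C(D.Pt, ℝ)) (x : ℝ) : ℝ≥0∞ :=
  ENNReal.ofReal (ε / 2 * |deriv (fun x => v (D.param x)) x| ^ 2 +
    1 / (2 * ε) * F (v (D.param x)))

lemma param_circle_add_one (x : ℝ) : Domain.circle.param (x + 1) = Domain.circle.param x := by
  change ((x + 1 : ℝ) : UnitAddCircle) = (x : UnitAddCircle)
  simp

lemma deriv_periodic_of_periodic {f : ℝ → ℝ} {T : ℝ} (hf : Function.Periodic f T) :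
    Function.Periodic (deriv f) T := fun x => by
  rw [← deriv_comp_add_const, show (fun y => f (y + T)) = f from funext hf]

lemma density_circle_periodic (F : ℝ → ℝ) (ε : ℝ) (v : C(Domain.circle.Pt, ℝ)) :
    Function.Periodic (density Domain.circle F ε v) 1 := fun x => by
  have h := deriv_periodic_of_periodic (f := fun x => v (Domain.circle.param x)) (T := 1)
    (fun x => by simp only [param_circle_add_one])
  simp only [density, h x, param_circle_add_one]

/-- The energy on a short interval of parameters is part of the energy near its image in `M`. -/
lemma setLIntegral_density_le (D : Domain) (F : ℝ → ℝ) (ε : ℝ) (v : C(D.Pt, ℝ)) {s t : ℝ}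
    (hs : s ∈ D.valid) (ht : t ∈ D.valid) (hst : t ≤ s + 1 ∨ D ≠ Domain.circle)
    {U : Set D.Pt} (hUm : MeasurableSet (D.param ⁻¹' U))
    (hU : ∀ y ∈ Set.Ioc s t, D.param y ∈ U) :
    ∫⁻ x in Set.Ioc s t, density D F ε v x ≤
      ∫⁻ x in D.param ⁻¹' U ∩ Set.Ioc D.left D.right, density D F ε v x := by
  cases D with
  | interval l r h =>
    exact lintegral_mono_set fun y hy =>
      ⟨hU y hy, (hs.1.trans_lt hy.1 : l < y), (hy.2.trans ht.2 : y ≤ r)⟩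
  | circle =>
    have hst : t ≤ s + 1 := hst.resolve_right (by simp)
    -- Cutting off outside the preimage of U preserves periodicity, so the window of length one
    -- starting at s can be moved to [0, 1].
    set h : ℝ → ℝ≥0∞ := (Domain.circle.param ⁻¹' U).indicator (density Domain.circle F ε v)
    have hper : Function.Periodic h 1 := fun x => by
      have := density_circle_periodic F ε v x
      have hiff : x + 1 ∈ Domain.circle.param ⁻¹' U ↔ x ∈ Domain.circle.param ⁻¹' U := by
        rw [Set.mem_preimage, Set.mem_preimage, param_circle_add_one]
      by_cases hx : x ∈ Domain.circle.param ⁻¹' U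
      · simp only [h, Set.indicator_of_mem hx, Set.indicator_of_mem (hiff.2 hx), this]
      · simp only [h, Set.indicator_of_notMem hx, Set.indicator_of_notMem (mt hiff.1 hx)]
    have key (u : ℝ) : ∫⁻ x in Set.Ioc u (u + 1), h x = ∫⁻ b : UnitAddCircle, hper.lift b :=
      UnitAddCircle.lintegral_preimage u hper.lift
    calc ∫⁻ x in Set.Ioc s t, density Domain.circle F ε v x
        = ∫⁻ x in Set.Ioc s t, h x := by
          refine setLIntegral_congr_fun measurableSet_Ioc fun x hx => ?_
          exact (Set.indicator_of_mem (show x ∈ Domain.circle.param ⁻¹' U from hU x hx) _).symm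
      _ ≤ ∫⁻ x in Set.Ioc s (s + 1), h x :=
          lintegral_mono_set (Set.Ioc_subset_Ioc_right hst)
      _ = ∫⁻ x in Set.Ioc 0 (0 + 1), h x := by rw [key, key]
      _ = _ := by
          rw [setLIntegral_indicator hUm]
          simp [Domain.left, Domain.right]

/-! ### The Modica–Mortola inequality -/

/-- A function of class C¹ is Lipschitz on the bounded range of f. No global Lipschitz bound is
available for `primG F`, since √F may be unbounded. -/
lemma AbsolutelyContinuousOnInterval.comp_contDiff {f g : ℝ → ℝ} {a b : ℝ}
    (hg : ContDiff ℝ 1 g) (hf : AbsolutelyContinuousOnInterval f a b) :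
    AbsolutelyContinuousOnInterval (fun x => g (f x)) a b := by
  obtain ⟨R, hR⟩ := hf.exists_bound
  obtain ⟨K, hK⟩ := (hg.contDiffOn (s := Set.Icc (-R) R)).exists_lipschitzOnWith (by decide)
    (convex_Icc _ _) isCompact_Icc
  rw [absolutelyContinuousOnInterval_iff] at hf ⊢
  intro ε hε
  obtain ⟨δ, hδ, h⟩ := hf (ε / (K + 1)) (by positivity)
  refine ⟨δ, hδ, fun E hE hlen => ?_⟩
  have hsum := h E hE hlen
  calc ∑ i ∈ Finset.range E.1, dist (g (f (E.2 i).1)) (g (f (E.2 i).2))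
      ≤ ∑ i ∈ Finset.range E.1, K * dist (f (E.2 i).1) (f (E.2 i).2) :=
        Finset.sum_le_sum fun i hi => hK.dist_le_mul _ (abs_le.1 (hR _ (hE.1 i hi).1)) _
          (abs_le.1 (hR _ (hE.1 i hi).2))
    _ = K * ∑ i ∈ Finset.range E.1, dist (f (E.2 i).1) (f (E.2 i).2) := by
        rw [Finset.mul_sum]
    _ ≤ (K + 1) * ∑ i ∈ Finset.range E.1, dist (f (E.2 i).1) (f (E.2 i).2) := by
        gcongr
        linarith
    _ < (K + 1) * (ε / (K + 1)) := by gcongr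
    _ = ε := by field_simp

/-- The signed primitive `∫₁ʸ √F`, so that `G = |primG|`. -/
noncomputable def primG (F : ℝ → ℝ) (y : ℝ) : ℝ := ∫ τ in (1 : ℝ)..y, √(F τ)

lemma hasDerivAt_primG {F : ℝ → ℝ} (hF : Continuous F) (y : ℝ) :
    HasDerivAt (primG F) (√(F y)) y := by
  have hc : Continuous fun τ => √(F τ) := hF.sqrt
  exact intervalIntegral.integral_hasDerivAt_right (hc.intervalIntegrable _ _)
    (hc.stronglyMeasurableAtFilter _ _) hc.continuousAt

lemma contDiff_primG {F : ℝ → ℝ} (hF : Continuous F) : ContDiff ℝ 1 (primG F) := by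
  rw [contDiff_one_iff_deriv]
  refine ⟨fun y => (hasDerivAt_primG hF y).differentiableAt, ?_⟩
  rw [show deriv (primG F) = fun y => √(F y) from funext fun y => (hasDerivAt_primG hF y).deriv]
  exact hF.sqrt

lemma continuous_primG {F : ℝ → ℝ} (hF : Continuous F) : Continuous (primG F) :=
  (contDiff_primG hF).continuous

@[simp] lemma primG_one (F : ℝ → ℝ) : primG F 1 = 0 := by simp [primG]

lemma abs_primG (F : ℝ → ℝ) (y : ℝ) : |primG F y| = G F y := rfl

lemma primG_nonneg (F : ℝ → ℝ) {y : ℝ} (hy : 1 ≤ y) : 0 ≤ primG F y :=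
  intervalIntegral.integral_nonneg hy fun _ _ => Real.sqrt_nonneg _

lemma primG_nonpos (F : ℝ → ℝ) {y : ℝ} (hy : y ≤ 1) : primG F y ≤ 0 := by
  rw [primG, intervalIntegral.integral_symm]
  exact neg_nonpos.2 (intervalIntegral.integral_nonneg hy fun _ _ => Real.sqrt_nonneg _)

lemma G_nonneg (F : ℝ → ℝ) (y : ℝ) : 0 ≤ G F y := abs_nonneg _

@[simp] lemma G_one (F : ℝ → ℝ) : G F 1 = 0 := by simp [G]

lemma G_pos {F : ℝ → ℝ} (hF : CondF1 F) {y : ℝ} (hy : y ≠ 1) : 0 < G F y := by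
  have hc : Continuous fun τ => √(F τ) := hF.1.sqrt
  have hpos (τ : ℝ) (hτ : τ ≠ 1) : 0 < √(F τ) :=
    Real.sqrt_pos.2 ((hF.2.1 τ).lt_of_ne fun h => hτ ((hF.2.2 τ).1 h.symm))
  rw [← abs_primG, abs_pos]
  rcases lt_or_gt_of_ne hy with h | h
  · refine ne_of_lt ?_
    rw [primG, intervalIntegral.integral_symm, neg_lt_zero]
    exact intervalIntegral.intervalIntegral_pos_of_pos_on (hc.intervalIntegrable _ _)
      (fun x hx => hpos x hx.2.ne) h
  · refine ne_of_gt ?_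
    exact intervalIntegral.intervalIntegral_pos_of_pos_on (hc.intervalIntegrable _ _)
      (fun x hx => hpos x hx.1.ne') h

/-- The Modica–Mortola inequality for an absolutely continuous function. -/
lemma ofReal_abs_primG_sub_le {F : ℝ → ℝ} (hF : CondF1 F) {f : ℝ → ℝ} {s t ε : ℝ} (hε : 0 < ε)
    (hst : s ≤ t) (hf : AbsolutelyContinuousOnInterval f s t) :
    ENNReal.ofReal |primG F (f t) - primG F (f s)| ≤
      ∫⁻ x in Set.Ioc s t,
        ENNReal.ofReal (ε / 2 * |deriv f x| ^ 2 + 1 / (2 * ε) * F (f x)) := by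
  have hac := AbsolutelyContinuousOnInterval.comp_contDiff (contDiff_primG hF.1) hf
  rw [← hac.integral_deriv_eq_sub, intervalIntegral.integral_of_le hst, ← Real.norm_eq_abs,
    ofReal_norm]
  refine (enorm_integral_le_lintegral_enorm _).trans ?_
  refine lintegral_mono_ae ?_
  filter_upwards [(ae_restrict_of_ae hf.ae_differentiableAt :
    ∀ᵐ x ∂volume.restrict (Set.Ioc s t), _), ae_restrict_mem measurableSet_Ioc] with x hx hxs
  have hd := hx (by rw [Set.uIcc_of_le hst]; exact Set.Ioc_subset_Icc_self hxs)
  have hcomp : HasDerivAt (fun x => primG F (f x)) (√(F (f x)) * deriv f x) x :=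
    (hasDerivAt_primG hF.1 (f x)).comp x hd.hasDerivAt
  rw [hcomp.deriv, ← ofReal_norm, Real.norm_eq_abs, abs_mul,
    abs_of_nonneg (Real.sqrt_nonneg _)]
  apply ENNReal.ofReal_le_ofReal
  have hsq := Real.sq_sqrt (hF.2.1 (f x))
  set q := √(F (f x))
  rw [← hsq]
  -- The gap in the inequality between arithmetic and geometric means is a perfect square.
  have h2 : ε / 2 * |deriv f x| ^ 2 + 1 / (2 * ε) * q ^ 2 - q * |deriv f x| =
      1 / (2 * ε) * (ε * |deriv f x| - q) ^ 2 := by field_simp; ring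
  have h3 : 0 ≤ 1 / (2 * ε) * (ε * |deriv f x| - q) ^ 2 := by positivity
  linarith

lemma MemH1.comp_integrable {D : Domain} {F : ℝ → ℝ} (hF : CondF1 F)
    {v : C(D.Pt, ℝ)} (hv : MemH1 D v) :
    IntervalIntegrable (fun x => |deriv (fun x => v (D.param x)) x| ^ 2) volume D.left D.right ∧
    IntervalIntegrable (fun x => F (v (D.param x))) volume D.left D.right := by
  constructor
  · rw [intervalIntegrable_iff_integrableOn_Ioo_of_le D.left_lt_right.le]
    exact hv.2.integrable_norm_pow (by norm_num)
  · have := D.continuous_param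
    exact (hF.1.comp (v.continuous.comp this)).intervalIntegrable _ _

lemma energy_nonneg {D : Domain} {F : ℝ → ℝ} (hF : CondF1 F) {ε : ℝ} (hε : 0 < ε)
    (v : C(D.Pt, ℝ)) : 0 ≤ energy D F ε v := by
  have h1 : 0 ≤ ∫ x in D.left..D.right, |deriv (fun x => v (D.param x)) x| ^ 2 :=
    intervalIntegral.integral_nonneg D.left_lt_right.le fun _ _ => by positivity
  have h2 : 0 ≤ ∫ x in D.left..D.right, F (v (D.param x)) :=
    intervalIntegral.integral_nonneg D.left_lt_right.le fun _ _ => hF.2.1 _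
  unfold energy
  positivity

lemma ofReal_energy {D : Domain} {F : ℝ → ℝ} (hF : CondF1 F) {ε : ℝ} (hε : 0 < ε)
    {v : C(D.Pt, ℝ)} (hv : MemH1 D v) :
    ENNReal.ofReal (energy D F ε v) = ∫⁻ x in Set.Ioc D.left D.right, density D F ε v x := by
  obtain ⟨h1, h2⟩ := hv.comp_integrable hF
  have hint := (h1.const_mul (ε / 2)).add (h2.const_mul (1 / (2 * ε)))
  rw [energy, ← intervalIntegral.integral_const_mul, ← intervalIntegral.integral_const_mul,
    ← intervalIntegral.integral_add (h1.const_mul _) (h2.const_mul _),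
    intervalIntegral.integral_of_le D.left_lt_right.le,
    ofReal_integral_eq_lintegral_ofReal]
  · rfl
  · exact (intervalIntegrable_iff_integrableOn_Ioc_of_le D.left_lt_right.le).1 hint
  · refine ae_of_all _ fun x => ?_
    have := hF.2.1 (v (D.param x))
    simp only [Pi.zero_apply]
    positivity

lemma ofReal_abs_primG_sub_le_density_of_mem_Icc {D : Domain} {F : ℝ → ℝ} (hF : CondF1 F) {ε : ℝ}
    (hε : 0 < ε) {v : C(D.Pt, ℝ)} (hv : MemH1 D v) {s t : ℝ} (hs : D.left ≤ s) (hst : s ≤ t)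
    (ht : t ≤ D.right) :
    ENNReal.ofReal |primG F (v (D.param t)) - primG F (v (D.param s))| ≤
      ∫⁻ x in Set.Ioc s t, density D F ε v x := by
  have hac : AbsolutelyContinuousOnInterval (fun x => v (D.param x)) s t := hv.1.mono ?_
  · exact ofReal_abs_primG_sub_le (f := fun x => v (D.param x)) hF hε hst hac
  rw [Set.uIcc_of_le hst, Set.uIcc_of_le D.left_lt_right.le]
  exact Set.Icc_subset_Icc hs ht

lemma ofReal_abs_sub_le_of_split {g : ℝ → ℝ} {E : ℝ → ℝ≥0∞} {s t u : ℝ} (hst : s ≤ t)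
    (htu : t ≤ u) (h1 : ENNReal.ofReal |g t - g s| ≤ ∫⁻ x in Set.Ioc s t, E x)
    (h2 : ENNReal.ofReal |g u - g t| ≤ ∫⁻ x in Set.Ioc t u, E x) :
    ENNReal.ofReal |g u - g s| ≤ ∫⁻ x in Set.Ioc s u, E x := by
  rw [← Set.Ioc_union_Ioc_eq_Ioc hst htu,
    lintegral_union measurableSet_Ioc (Set.Ioc_disjoint_Ioc_of_le le_rfl)]
  refine le_trans ?_ (add_le_add h1 h2)
  rw [← ENNReal.ofReal_add (abs_nonneg _) (abs_nonneg _)]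
  apply ENNReal.ofReal_le_ofReal
  rw [add_comm]
  exact abs_sub_le _ _ _

lemma param_circle_add_int (x : ℝ) (n : ℤ) :
    Domain.circle.param (x + n) = Domain.circle.param x := by
  have h : Function.Periodic Domain.circle.param 1 := param_circle_add_one
  simpa using h.int_mul n x

lemma setLIntegral_Ioc_add_int {E : ℝ → ℝ≥0∞} (hE : Function.Periodic E 1) (s t : ℝ) (n : ℤ) :
    ∫⁻ x in Set.Ioc (s + n) (t + n), E x = ∫⁻ x in Set.Ioc s t, E x := by
  have h := (measurePreserving_add_right (volume : Measure ℝ) (n : ℝ)).setLIntegral_comp_preimage_emb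
    (MeasurableEquiv.addRight (n : ℝ)).measurableEmbedding E (Set.Ioc (s + n) (t + n))
  rw [← h]
  have h1 : (fun x : ℝ => x + n) ⁻¹' Set.Ioc (s + n) (t + n) = Set.Ioc s t := by
    ext x; simp
  rw [h1]
  refine lintegral_congr fun x => ?_
  simpa using (hE.int_mul n x)

/-- The Modica–Mortola inequality in the coordinate of `M`; on the circle the parameter
interval may pass over integers. -/
lemma ofReal_abs_primG_sub_le_density {D : Domain} {F : ℝ → ℝ} (hF : CondF1 F) {ε : ℝ}
    (hε : 0 < ε) {v : C(D.Pt, ℝ)} (hv : MemH1 D v) {s t : ℝ} (hs : s ∈ D.valid) (hst : s ≤ t)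
    (ht : t ∈ D.valid) (hst' : t ≤ s + 1 ∨ D ≠ Domain.circle) :
    ENNReal.ofReal |primG F (v (D.param t)) - primG F (v (D.param s))| ≤
      ∫⁻ x in Set.Ioc s t, density D F ε v x := by
  cases D with
  | interval l r h => exact ofReal_abs_primG_sub_le_density_of_mem_Icc hF hε hv hs.1 hst ht.2
  | circle =>
    have hst' : t ≤ s + 1 := hst'.resolve_right (by simp)
    have key (n : ℤ) (s t : ℝ) (h1 : n ≤ s) (h2 : s ≤ t) (h3 : t ≤ n + 1) :
        ENNReal.ofReal |primG F (v (Domain.circle.param t)) -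
          primG F (v (Domain.circle.param s))| ≤
        ∫⁻ x in Set.Ioc s t, density Domain.circle F ε v x := by
      have := ofReal_abs_primG_sub_le_density_of_mem_Icc hF hε hv (s := s - n) (t := t - n)
        (show (0 : ℝ) ≤ s - n by linarith) (by linarith) (show t - n ≤ (1 : ℝ) by linarith)
      rw [← setLIntegral_Ioc_add_int (density_circle_periodic F ε v) _ _ n,
        ← param_circle_add_int (t - n) n, ← param_circle_add_int (s - n) n] at this
      simpa using this
    have h1 := Int.floor_le s
    have h2 := Int.lt_floor_add_one s
    -- Since t ≤ s + 1 < ⌊s⌋ + 2, the interval passes over at most the one integer ⌊s⌋ + 1; it is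
    -- split there.
    rcases le_total t (⌊s⌋ + 1) with h | h
    · exact key ⌊s⌋ s t h1 hst h
    · exact ofReal_abs_sub_le_of_split (g := fun x => primG F (v (Domain.circle.param x))) h2.le h
        (key ⌊s⌋ s _ h1 h2.le le_rfl)
        (key (⌊s⌋ + 1) _ t (by push_cast; rfl) h (by push_cast; linarith))

/-! ### Boundary points, and density of the points with value {1} -/

namespace Domain

/-- The window is half-open because its two ends may be the same point of the circle. This pulls
countability back from M to the parameters. -/
lemma injOn_param (D : Domain) (s : ℝ) :
    Set.InjOn D.param (D.valid ∩ Set.Ioc s (s + 1)) := by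
  cases D with
  | interval l r h =>
    intro t ht u hu htu
    have := congrArg (Subtype.val : Set.Icc l r → ℝ) htu
    change (Set.projIcc l r h.le t : ℝ) = Set.projIcc l r h.le u at this
    rwa [Set.projIcc_of_mem h.le ht.1, Set.projIcc_of_mem h.le hu.1] at this
  | circle =>
    intro t ht u hu htu
    have : Fact ((0 : ℝ) < 1) := ⟨one_pos⟩
    exact (AddCircle.coe_eq_coe_iff_of_mem_Ioc (p := (1 : ℝ)) ht.2 hu.2).1 htu

lemma exists_Icc_subset_valid (D : Domain) {s ρ : ℝ} (hs : s ∈ D.valid) (hρ : 0 < ρ) :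
    ∃ t u, t < u ∧ Set.Icc t u ⊆ D.valid ∧ ∀ y ∈ Set.Icc t u, |y - s| < ρ := by
  cases D with
  | interval l r h =>
    have hs : s ∈ Set.Icc l r := hs
    change ∃ t u, t < u ∧ Set.Icc t u ⊆ Set.Icc l r ∧ _
    rcases hs.2.lt_or_eq with h1 | h1
    · refine ⟨s, min (s + ρ / 2) r, lt_min (by linarith) h1,
        Set.Icc_subset_Icc hs.1 (min_le_right _ _), fun y hy => ?_⟩
      have := hy.2.trans (min_le_left _ _)
      rw [abs_lt]
      constructor <;> linarith [hy.1]
    · refine ⟨max (s - ρ / 2) l, s, max_lt (by linarith) (by linarith),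
        Set.Icc_subset_Icc (le_max_right _ _) hs.2, fun y hy => ?_⟩
      have := (le_max_left _ _).trans hy.1
      rw [abs_lt]
      constructor <;> linarith [hy.2]
  | circle =>
    refine ⟨s, s + ρ / 2, by linarith, Set.subset_univ _, fun y hy => ?_⟩
    rw [abs_lt]
    constructor <;> linarith [hy.1, hy.2]

lemma exists_forall_mem_valid (D : Domain) {s : ℝ} (hs : s ∈ D.valid)
    (hb : D.param s ∉ D.boundary) : ∃ ρ > 0, ∀ t, |t - s| < ρ → t ∈ D.valid := by
  cases D with
  | interval l r h =>
    have hs : s ∈ Set.Icc l r := hs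
    have hb' : ¬ ((Set.projIcc l r h.le s : ℝ) = l ∨ (Set.projIcc l r h.le s : ℝ) = r) := hb
    rw [Set.projIcc_of_mem h.le hs, not_or] at hb'
    have h1 : l < s := hs.1.lt_of_ne (Ne.symm hb'.1)
    have h2 : s < r := hs.2.lt_of_ne hb'.2
    refine ⟨min (s - l) (r - s), lt_min (by linarith) (by linarith), fun t ht => ?_⟩
    have h3 := abs_lt.1 (ht.trans_le (min_le_left _ _))
    have h4 := abs_lt.1 (ht.trans_le (min_le_right _ _))
    exact ⟨by linarith, by linarith⟩
  | circle => exact ⟨1, one_pos, fun _ _ => trivial⟩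

lemma valid_of_mem_boundary (D : Domain) {s : ℝ} (hs : s ∈ D.valid)
    (hb : D.param s ∈ D.boundary) :
    D ≠ circle ∧ ((s = D.left ∧ D.valid = Set.Icc s D.right) ∨
      (s = D.right ∧ D.valid = Set.Icc D.left s)) := by
  cases D with
  | interval l r h =>
    have hs : s ∈ Set.Icc l r := hs
    have hb' : ((Set.projIcc l r h.le s : ℝ) = l ∨ (Set.projIcc l r h.le s : ℝ) = r) := hb
    rw [Set.projIcc_of_mem h.le hs] at hb'
    refine ⟨by simp, ?_⟩
    rcases hb' with hb' | hb'
    · exact Or.inl ⟨hb', by simp only at hb'; rw [hb']; rfl⟩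
    · exact Or.inr ⟨hb', by simp only at hb'; rw [hb']; rfl⟩
  | circle => exact absurd hb (Set.notMem_empty _)

end Domain

/-- Otherwise a nonempty open interval of parameters would inject into the countable exceptional
set, yet it has positive length. -/
lemma classA₀.exists_eq_one {D : Domain} {Ξ : D.Pt → Set ℝ} (hΞ : Ξ ∈ classA₀ D.Pt) {s t : ℝ}
    (hst : s < t) (hv : Set.Icc s t ⊆ D.valid) : ∃ u ∈ Set.Ioo s t, Ξ (D.param u) = {1} := by
  by_contra! hcon
  set t' := min t (s + 1)
  have hst' : s < t' := lt_min hst (by linarith)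
  have hsub : Set.Ioo s t' ⊆ D.valid ∩ Set.Ioc s (s + 1) := fun u hu =>
    ⟨hv ⟨hu.1.le, hu.2.le.trans (min_le_left _ _)⟩, hu.1, hu.2.le.trans (min_le_right _ _)⟩
  have hc : (Set.Ioo s t').Countable := by
    refine Set.countable_of_injective_of_countable_image ((D.injOn_param s).mono hsub)
      (hΞ.2.mono ?_)
    rintro _ ⟨u, hu, rfl⟩
    exact hcon u ⟨hu.1, hu.2.trans_le (min_le_left _ _)⟩
  have := hc.measure_zero volume
  rw [Real.volume_Ioo, ENNReal.ofReal_eq_zero] at this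
  linarith

/-- The points with value {1} are dense and the graph is closed. -/
lemma classA₀.one_mem {D : Domain} {Ξ : D.Pt → Set ℝ} (hΞ : Ξ ∈ classA₀ D.Pt) (x : D.Pt) :
    (1 : ℝ) ∈ Ξ x := by
  have hc : IsClosed (graph Ξ) := IsCompact.isClosed hΞ.1.1
  suffices WithLp.toLp 2 (x, (1 : ℝ)) ∈ closure (graph Ξ) by rwa [hc.closure_eq] at this
  obtain ⟨s, hs, rfl⟩ := D.exists_rep x
  rw [Metric.mem_closure_iff]
  intro ρ hρ
  obtain ⟨t, u, htu, hv, hd⟩ := D.exists_Icc_subset_valid hs hρ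
  obtain ⟨y, hy, hy1⟩ := classA₀.exists_eq_one hΞ htu hv
  refine ⟨WithLp.toLp 2 (D.param y, 1), ?_, ?_⟩
  · change (1 : ℝ) ∈ Ξ (D.param y)
    rw [hy1]; rfl
  · refine (dist_le_add_of_withLp _ _).trans_lt ?_
    simp only [WithLp.toLp_fst, WithLp.toLp_snd, dist_self, add_zero]
    rw [dist_comm]
    exact (D.dist_param_le _ _).trans_lt (hd y (Set.Ioo_subset_Icc_self hy))

lemma classA₀.eq_Icc {D : Domain} {Ξ : D.Pt → Set ℝ} (hΞ : Ξ ∈ classA₀ D.Pt) (x : D.Pt) :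
    Ξ x = Set.Icc (sInf (Ξ x)) (sSup (Ξ x)) ∧ sInf (Ξ x) ≤ 1 ∧ 1 ≤ sSup (Ξ x) := by
  obtain ⟨p, q, hpq, h⟩ := hΞ.1.2 x
  have h1 := classA₀.one_mem hΞ x
  rw [h] at h1
  rw [h, csInf_Icc hpq, csSup_Icc hpq]
  exact ⟨rfl, h1⟩

/-! ### Local lower bounds -/

/-- The energy carried by a subset of `M`. -/
noncomputable def localEnergy (D : Domain) (F : ℝ → ℝ) (ε : ℝ) (v : C(D.Pt, ℝ))
    (U : Set D.Pt) : ℝ≥0∞ :=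
  ∫⁻ x in D.param ⁻¹' U ∩ Set.Ioc D.left D.right, density D F ε v x

lemma energy_le_energyB {D : Domain} {F : ℝ → ℝ} {a : D.Pt} {b : ℝ} (hb : 0 ≤ b) (ε : ℝ)
    (v : C(D.Pt, ℝ)) : energy D F ε v ≤ energyB D F a b ε v :=
  le_add_of_nonneg_right (by positivity)

lemma sum_localEnergy_le {D : Domain} {F : ℝ → ℝ} (hF : CondF1 F) {ε : ℝ} (hε : 0 < ε)
    {v : C(D.Pt, ℝ)} (hv : MemH1 D v) (T : Finset D.Pt) {U : D.Pt → Set D.Pt}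
    (hU : ∀ x, IsOpen (U x)) (hd : (T : Set D.Pt).PairwiseDisjoint U) :
    ∑ x ∈ T, localEnergy D F ε v (U x) ≤ ENNReal.ofReal (energy D F ε v) := by
  rw [ofReal_energy hF hε hv]
  have hm (x : D.Pt) : MeasurableSet (D.param ⁻¹' U x ∩ Set.Ioc D.left D.right) :=
    ((hU x).preimage D.continuous_param).measurableSet.inter measurableSet_Ioc
  simp only [localEnergy]
  rw [← lintegral_biUnion_finset (fun x hx y hy hxy => ?_) (fun x _ => hm x)]
  · exact lintegral_mono_set (Set.iUnion₂_subset fun x _ => Set.inter_subset_right)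
  · exact ((hd hx hy hxy).preimage D.param).mono Set.inter_subset_left Set.inter_subset_left

lemma localEnergy_le {D : Domain} {F : ℝ → ℝ} (hF : CondF1 F) {ε : ℝ} (hε : 0 < ε)
    {v : C(D.Pt, ℝ)} (hv : MemH1 D v) (U : Set D.Pt) :
    localEnergy D F ε v U ≤ ENNReal.ofReal (energy D F ε v) := by
  rw [ofReal_energy hF hε hv]
  exact lintegral_mono_set Set.inter_subset_right

/-- Local lower bounds add up to a lower bound of the energy. -/
lemma tsum_add_le_liminf {D : Domain} {F : ℝ → ℝ} (hF : CondF1 F) {a : D.Pt} {b : ℝ}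
    (hb : 0 ≤ b) {v : ℝ → C(D.Pt, ℝ)} (hv : ∀ ε ∈ Set.Ioo (0 : ℝ) 1, MemH1 D (v ε))
    (c : D.Pt → ℝ≥0∞) (B : ℝ≥0∞)
    (hc : ∀ x, ∀ U, IsOpen U → x ∈ U → ∀ η : ℝ≥0∞, 0 < η →
      ∀ᶠ ε in 𝓝[>] (0 : ℝ), c x ≤ localEnergy D F ε (v ε) U + η)
    (hB : ∀ η : ℝ≥0∞, 0 < η → ∀ᶠ ε in 𝓝[>] (0 : ℝ), B ≤ ENNReal.ofReal (b * v ε a ^ 2) + η) :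
    ∑' x, c x + B ≤
      liminf (fun ε => ENNReal.ofReal (energyB D F a b ε (v ε))) (𝓝[>] 0) := by
  rw [ENNReal.tsum_eq_iSup_sum, ENNReal.iSup_add]
  refine iSup_le fun T => ?_
  obtain ⟨U, hU, hd⟩ := T.finite_toSet.t2_separation
  refine ENNReal.le_of_forall_pos_le_add fun η hη _ => ?_
  -- One share of the error for each point of T and one for the term with b.
  set η' : ℝ≥0∞ := η / (T.card + 1)
  have hη' : 0 < η' := ENNReal.div_pos (by exact_mod_cast hη.ne') (by finiteness)
  have hsum : T.card * η' + η' = η := by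
    rw [← add_one_mul, ENNReal.mul_div_cancel (by positivity) (by finiteness)]
  rw [← tsub_le_iff_right]
  refine le_liminf_of_le (by isBoundedDefault) ?_
  filter_upwards [(eventually_all_finset T).2 fun x _ => hc x (U x) (hU x).2 (hU x).1 η' hη',
    hB η' hη', Ioo_mem_nhdsGT one_pos] with ε h1 h2 hε
  rw [tsub_le_iff_right]
  calc ∑ x ∈ T, c x + B
      ≤ ∑ x ∈ T, (localEnergy D F ε (v ε) (U x) + η') +
          (ENNReal.ofReal (b * v ε a ^ 2) + η') := add_le_add (Finset.sum_le_sum h1) h2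
    _ = (∑ x ∈ T, localEnergy D F ε (v ε) (U x) + ENNReal.ofReal (b * v ε a ^ 2)) +
          (T.card * η' + η') := by
        rw [Finset.sum_add_distrib, Finset.sum_const, nsmul_eq_mul]; ring
    _ ≤ (ENNReal.ofReal (energy D F ε (v ε)) + ENNReal.ofReal (b * v ε a ^ 2)) + η := by
        rw [hsum]
        gcongr
        exact sum_localEnergy_le hF hε.1 (hv ε hε) T (fun x => (hU x).2) hd
    _ = ENNReal.ofReal (energyB D F a b ε (v ε)) + η := by
        rw [← ENNReal.ofReal_add (energy_nonneg hF hε.1 _) (by positivity)]; rfl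

/-- The local energy is at least the variation of `primG F ∘ v` along four points in order. -/
lemma ofReal_chain_le_localEnergy {D : Domain} {F : ℝ → ℝ} (hF : CondF1 F) {ε : ℝ}
    (hε : 0 < ε) {v : C(D.Pt, ℝ)} (hv : MemH1 D v) {U : Set D.Pt} (hUo : IsOpen U)
    {s p q t : ℝ} (hs : s ∈ D.valid) (hsp : s ≤ p) (hpq : p ≤ q) (hqt : q ≤ t)
    (ht : t ∈ D.valid) (hst : t ≤ s + 1) (hU : ∀ y ∈ Set.Ioc s t, D.param y ∈ U) :
    ENNReal.ofReal (|primG F (v (D.param p)) - primG F (v (D.param s))| +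
      |primG F (v (D.param q)) - primG F (v (D.param p))| +
      |primG F (v (D.param t)) - primG F (v (D.param q))|) ≤ localEnergy D F ε v U := by
  have hp : p ∈ D.valid := D.ordConnected_valid.out hs ht ⟨hsp, hpq.trans hqt⟩
  have hq : q ∈ D.valid := D.ordConnected_valid.out hs ht ⟨hsp.trans hpq, hqt⟩
  refine le_trans ?_ (setLIntegral_density_le D F ε v hs ht (Or.inl hst)
    (hUo.preimage D.continuous_param).measurableSet hU)
  rw [← Set.Ioc_union_Ioc_eq_Ioc (hsp.trans hpq) hqt,
    lintegral_union measurableSet_Ioc (Set.Ioc_disjoint_Ioc_of_le le_rfl),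
    ← Set.Ioc_union_Ioc_eq_Ioc hsp hpq,
    lintegral_union measurableSet_Ioc (Set.Ioc_disjoint_Ioc_of_le le_rfl),
    ENNReal.ofReal_add (by positivity) (by positivity),
    ENNReal.ofReal_add (by positivity) (by positivity)]
  refine add_le_add (add_le_add ?_ ?_) ?_
  · exact ofReal_abs_primG_sub_le_density hF hε hv hs hsp hp (Or.inl (by linarith))
  · exact ofReal_abs_primG_sub_le_density hF hε hv hp hpq hq (Or.inl (by linarith))
  · exact ofReal_abs_primG_sub_le_density hF hε hv hq hqt ht (Or.inl (by linarith))

lemma Domain.exists_radius (D : Domain) {s : ℝ} {U : Set D.Pt} (hU : IsOpen U)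
    (hs : D.param s ∈ U) : ∃ ρ > 0, ρ ≤ 1 / 2 ∧ ∀ t, |t - s| < ρ → D.param t ∈ U := by
  obtain ⟨ρ, hρ, h⟩ := Metric.isOpen_iff.1 (hU.preimage D.continuous_param) s hs
  refine ⟨min ρ (1 / 2), by positivity, min_le_right _ _, fun t ht => h ?_⟩
  exact ht.trans_le (min_le_left _ _)

lemma GraphTendsto.eventually_exists_lift {D : Domain} {F : ℝ → ℝ} (hF : CondF1 F)
    {v : ℝ → C(D.Pt, ℝ)} {Ξ : D.Pt → Set ℝ} (h : GraphTendsto v Ξ) {s : ℝ} (hs : s ∈ D.valid)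
    {y : ℝ} (hy : y ∈ Ξ (D.param s)) {ρ η : ℝ} (hρ : 0 < ρ) (hη : 0 < η) :
    ∀ᶠ ε in 𝓝[>] (0 : ℝ), ∃ t ∈ D.valid, |t - s| < ρ ∧
      |primG F (v ε (D.param t)) - primG F y| < η := by
  obtain ⟨δ, hδ, hc⟩ := Metric.continuousAt_iff.1 (continuous_primG hF.1).continuousAt η hη
  filter_upwards [h.eventually_exists_near hy (lt_min hρ hδ)] with ε ⟨p, hp, hpy⟩
  obtain ⟨t, ht, rfl, htd⟩ := D.exists_lift hs p
  exact ⟨t, ht, htd.trans_lt (hp.trans_le (min_le_left _ _)),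
    hc (hpy.trans_le (min_le_right _ _))⟩

lemma ENNReal_ofReal_le_add_of_sub_le {c d η : ℝ} {X : ℝ≥0∞}
    (h : c - η ≤ d) (hd : ENNReal.ofReal d ≤ X) :
    ENNReal.ofReal c ≤ X + ENNReal.ofReal η := by
  calc ENNReal.ofReal c ≤ ENNReal.ofReal (d + η) := ENNReal.ofReal_le_ofReal (by linarith)
    _ ≤ ENNReal.ofReal d + ENNReal.ofReal η := ENNReal.ofReal_add_le
    _ ≤ X + ENNReal.ofReal η := by gcongr

lemma exists_ofReal_le {η : ℝ≥0∞} (hη : 0 < η) : ∃ r : ℝ, 0 < r ∧ ENNReal.ofReal r ≤ η := by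
  obtain ⟨r, hr, h⟩ := ENNReal.lt_iff_exists_nnreal_btwn.1 hη
  exact ⟨r, by exact_mod_cast hr, by simpa using h.le⟩

/-- Two values at the same point of the limit cost at least the variation between them. -/
lemma eventually_ofReal_abs_le {D : Domain} {F : ℝ → ℝ} (hF : CondF1 F)
    {v : ℝ → C(D.Pt, ℝ)} (hv : ∀ ε ∈ Set.Ioo (0 : ℝ) 1, MemH1 D (v ε))
    {Ξ : D.Pt → Set ℝ} (h : GraphTendsto v Ξ) {x : D.Pt} {y z : ℝ} (hy : y ∈ Ξ x)
    (hz : z ∈ Ξ x) {U : Set D.Pt} (hU : IsOpen U) (hx : x ∈ U) {η : ℝ≥0∞} (hη : 0 < η) :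
    ∀ᶠ ε in 𝓝[>] (0 : ℝ), ENNReal.ofReal |primG F y - primG F z| ≤
      localEnergy D F ε (v ε) U + η := by
  obtain ⟨r, hr, hrη⟩ := exists_ofReal_le hη
  obtain ⟨s, hs, rfl⟩ := D.exists_rep x
  obtain ⟨ρ, hρ, hρ1, hρU⟩ := D.exists_radius hU hx
  filter_upwards [h.eventually_exists_lift hF hs hy hρ (half_pos hr),
    h.eventually_exists_lift hF hs hz hρ (half_pos hr), Ioo_mem_nhdsGT one_pos]
    with ε ⟨p, hp, hps, hpy⟩ ⟨q, hq, hqs, hqz⟩ hε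
  rw [abs_lt] at hps hqs
  have hin (t u : ℝ) (ht : s - ρ < t) (hu : u < s + ρ) : ∀ w ∈ Set.Ioc t u, D.param w ∈ U :=
    fun w hw => hρU w (abs_lt.2 ⟨by linarith [hw.1], by linarith [hw.2]⟩)
  refine (ENNReal_ofReal_le_add_of_sub_le (d := |primG F (v ε (D.param p)) -
    primG F (v ε (D.param q))|) ?_ ?_).trans (add_le_add le_rfl hrη)
  · have h1 := abs_sub_le (primG F y) (primG F (v ε (D.param p))) (primG F z)
    have h2 := abs_sub_le (primG F (v ε (D.param p))) (primG F (v ε (D.param q))) (primG F z)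
    rw [abs_sub_comm] at hpy
    linarith
  · rcases le_total p q with hpq | hpq
    · have := ofReal_chain_le_localEnergy hF hε.1 (hv ε hε) hU hp le_rfl hpq le_rfl hq
        (by linarith) (hin p q (by linarith) (by linarith))
      simpa [abs_sub_comm] using this
    · have := ofReal_chain_le_localEnergy hF hε.1 (hv ε hε) hU hq le_rfl hpq le_rfl hp
        (by linarith) (hin q p (by linarith) (by linarith))
      simpa [abs_sub_comm] using this

/-- The contribution of the point `x` to the limit functional. -/
noncomputable def jumpCost (D : Domain) (F : ℝ → ℝ) (Ξ : D.Pt → Set ℝ) (x : D.Pt) : ℝ :=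
  2 * (G F (sInf (Ξ x)) + G F (sSup (Ξ x))) -
    kappa D x * max (G F (sInf (Ξ x))) (G F (sSup (Ξ x)))

lemma limitEnergy_eq {D : Domain} {F : ℝ → ℝ} {Ξ : D.Pt → Set ℝ} (hΞ : Ξ ∈ classA₀ D.Pt) :
    limitEnergy D F Ξ = ∑' x : exceptional Ξ, ENNReal.ofReal (jumpCost D F Ξ x) :=
  if_pos hΞ

lemma GraphTendsto.eventually_abs_primG_lt {D : Domain} {F : ℝ → ℝ} (hF : CondF1 F)
    {v : ℝ → C(D.Pt, ℝ)} {Ξ : D.Pt → Set ℝ} (h : GraphTendsto v Ξ) (hΞ : Ξ ∈ classB D.Pt)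
    {x : D.Pt} (hx : Ξ x = {1}) {r : ℝ} (hr : 0 < r) :
    ∀ᶠ ε in 𝓝[>] (0 : ℝ), |primG F (v ε x)| < r := by
  refine h.eventually_mem hΞ (U := {z | |primG F z| < r})
    (isOpen_lt (continuous_primG hF.1).abs continuous_const) ?_
  rw [hx, Set.singleton_subset_iff]
  simpa using hr

/-- A point of the limit costs at least its contribution to the limit functional. -/
lemma eventually_ofReal_jumpCost_le {D : Domain} {F : ℝ → ℝ} (hF : CondF1 F)
    {v : ℝ → C(D.Pt, ℝ)} (hv : ∀ ε ∈ Set.Ioo (0 : ℝ) 1, MemH1 D (v ε))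
    {Ξ : D.Pt → Set ℝ} (hΞ : Ξ ∈ classA₀ D.Pt) (h : GraphTendsto v Ξ) (x : D.Pt)
    {U : Set D.Pt} (hU : IsOpen U) (hx : x ∈ U) {η : ℝ≥0∞} (hη : 0 < η) :
    ∀ᶠ ε in 𝓝[>] (0 : ℝ), ENNReal.ofReal (jumpCost D F Ξ x) ≤
      localEnergy D F ε (v ε) U + η := by
  obtain ⟨r, hr, hrη⟩ := exists_ofReal_le hη
  obtain ⟨s, hs, rfl⟩ := D.exists_rep x
  obtain ⟨ρ₀, hρ₀, hρ₀1, hρ₀U⟩ := D.exists_radius hU hx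
  obtain ⟨hIcc, hm1, hM1⟩ := classA₀.eq_Icc hΞ (D.param s)
  set m := sInf (Ξ (D.param s)) with hm
  set N := sSup (Ξ (D.param s)) with hN
  have hmm : m ∈ Ξ (D.param s) := by rw [hIcc]; exact ⟨le_rfl, hm1.trans hM1⟩
  have hNm : N ∈ Ξ (D.param s) := by rw [hIcc]; exact ⟨hm1.trans hM1, le_rfl⟩
  have hGm : primG F m = -G F m := by
    rw [← abs_primG, abs_of_nonpos (primG_nonpos F hm1), neg_neg]
  have hGN : primG F N = G F N := by rw [← abs_primG, abs_of_nonneg (primG_nonneg F hM1)]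
  -- The interior chain has three increments, hence six approximate endpoint values in all.
  have hr6 : 0 < r / 6 := by positivity
  have hmax1 := le_max_left (G F m) (G F N)
  have hmax2 := le_max_right (G F m) (G F N)
  by_cases hbd : D.param s ∈ D.boundary
  · have hκ : jumpCost D F Ξ (D.param s) =
        2 * (G F m + G F N) - max (G F m) (G F N) := by
      simp [jumpCost, kappa, Set.indicator_of_mem hbd, hm, hN]
    rw [hκ]
    obtain ⟨-, ⟨hsl, hval⟩ | ⟨hsr, hval⟩⟩ := D.valid_of_mem_boundary hs hbd
    · have hlen : 0 < D.right - s := by rw [hsl]; linarith [D.left_lt_right]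
      obtain ⟨ρ, hρ, hρ1, hρ2⟩ : ∃ ρ > 0, ρ ≤ ρ₀ ∧ ρ ≤ D.right - s :=
        ⟨min ρ₀ (D.right - s), lt_min hρ₀ hlen, min_le_left _ _, min_le_right _ _⟩
      -- β is at distance more than ρ/4 from s, while the points realising the two ends are within
      -- ρ/4, so β lies beyond both.
      obtain ⟨β, hβ, hβ1⟩ := classA₀.exists_eq_one hΞ (s := s + ρ / 4) (t := s + ρ / 2)
        (by linarith) (by
          rw [hval]; exact Set.Icc_subset_Icc (by linarith) (by linarith))
      filter_upwards [h.eventually_exists_lift hF hs hmm (ρ := ρ / 4) (by positivity) hr6,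
        h.eventually_exists_lift hF hs hNm (ρ := ρ / 4) (by positivity) hr6,
        h.eventually_abs_primG_lt hF hΞ.1.1 hβ1 hr6, Ioo_mem_nhdsGT one_pos]
        with ε ⟨p, hp, hps, hpm⟩ ⟨q, hq, hqs, hqN⟩ hb hε
      have hβv : β ∈ D.valid := by
        rw [hval]; exact ⟨by linarith [hβ.1], by linarith [hβ.2]⟩
      rw [abs_lt] at hps hqs hpm hqN hb
      have hin (t u : ℝ) (ht : s - ρ < t) (hu : u < s + ρ) : ∀ w ∈ Set.Ioc t u, D.param w ∈ U :=
        fun w hw => hρ₀U w (abs_lt.2 ⟨by linarith [hw.1], by linarith [hw.2]⟩)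
      -- The order of the two ends is not known. The one closer to the boundary is paid once and the
      -- other twice, so either order costs at least twice the sum minus the maximum.
      rcases le_total p q with hpq | hpq
      · refine (ENNReal_ofReal_le_add_of_sub_le ?_ (ofReal_chain_le_localEnergy hF hε.1 (hv ε hε)
          hU hp le_rfl hpq (t := β) (by linarith [hβ.1]) hβv (by linarith [hβ.2])
          (hin p β (by linarith) (by linarith [hβ.2])))).trans (add_le_add le_rfl hrη)
        have h1 := le_abs_self (primG F (v ε (D.param q)) - primG F (v ε (D.param p)))
        have h2 := neg_le_abs (primG F (v ε (D.param β)) - primG F (v ε (D.param q)))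
        have h3 := abs_nonneg (primG F (v ε (D.param p)) - primG F (v ε (D.param p)))
        linarith
      · refine (ENNReal_ofReal_le_add_of_sub_le ?_ (ofReal_chain_le_localEnergy hF hε.1 (hv ε hε)
          hU hq le_rfl hpq (t := β) (by linarith [hβ.1]) hβv (by linarith [hβ.2])
          (hin q β (by linarith) (by linarith [hβ.2])))).trans (add_le_add le_rfl hrη)
        have h1 := neg_le_abs (primG F (v ε (D.param p)) - primG F (v ε (D.param q)))
        have h2 := le_abs_self (primG F (v ε (D.param β)) - primG F (v ε (D.param p)))
        have h3 := abs_nonneg (primG F (v ε (D.param q)) - primG F (v ε (D.param q)))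
        linarith
    · have hlen : 0 < s - D.left := by rw [hsr]; linarith [D.left_lt_right]
      obtain ⟨ρ, hρ, hρ1, hρ2⟩ : ∃ ρ > 0, ρ ≤ ρ₀ ∧ ρ ≤ s - D.left :=
        ⟨min ρ₀ (s - D.left), lt_min hρ₀ hlen, min_le_left _ _, min_le_right _ _⟩
      obtain ⟨α, hα, hα1⟩ := classA₀.exists_eq_one hΞ (s := s - ρ / 2) (t := s - ρ / 4)
        (by linarith) (by
          rw [hval]; exact Set.Icc_subset_Icc (by linarith) (by linarith))
      filter_upwards [h.eventually_exists_lift hF hs hmm (ρ := ρ / 4) (by positivity) hr6,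
        h.eventually_exists_lift hF hs hNm (ρ := ρ / 4) (by positivity) hr6,
        h.eventually_abs_primG_lt hF hΞ.1.1 hα1 hr6, Ioo_mem_nhdsGT one_pos]
        with ε ⟨p, hp, hps, hpm⟩ ⟨q, hq, hqs, hqN⟩ ha hε
      have hαv : α ∈ D.valid := by
        rw [hval]; exact ⟨by linarith [hα.1], by linarith [hα.2]⟩
      rw [abs_lt] at hps hqs hpm hqN ha
      have hin (t u : ℝ) (ht : s - ρ < t) (hu : u < s + ρ) : ∀ w ∈ Set.Ioc t u, D.param w ∈ U :=
        fun w hw => hρ₀U w (abs_lt.2 ⟨by linarith [hw.1], by linarith [hw.2]⟩)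
      rcases le_total p q with hpq | hpq
      · refine (ENNReal_ofReal_le_add_of_sub_le ?_ (ofReal_chain_le_localEnergy hF hε.1 (hv ε hε)
          hU hαv (by linarith [hα.2]) hpq le_rfl hq (by linarith [hα.1])
          (hin α q (by linarith [hα.1]) (by linarith)))).trans (add_le_add le_rfl hrη)
        have h1 := le_abs_self (primG F (v ε (D.param q)) - primG F (v ε (D.param p)))
        have h2 := neg_le_abs (primG F (v ε (D.param p)) - primG F (v ε (D.param α)))
        have h3 := abs_nonneg (primG F (v ε (D.param q)) - primG F (v ε (D.param q)))
        linarith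
      · refine (ENNReal_ofReal_le_add_of_sub_le ?_ (ofReal_chain_le_localEnergy hF hε.1 (hv ε hε)
          hU hαv (by linarith [hα.2]) hpq le_rfl hp (by linarith [hα.1])
          (hin α p (by linarith [hα.1]) (by linarith)))).trans (add_le_add le_rfl hrη)
        have h1 := neg_le_abs (primG F (v ε (D.param p)) - primG F (v ε (D.param q)))
        have h2 := le_abs_self (primG F (v ε (D.param q)) - primG F (v ε (D.param α)))
        have h3 := abs_nonneg (primG F (v ε (D.param p)) - primG F (v ε (D.param p)))
        linarith
  · have hκ : jumpCost D F Ξ (D.param s) = 2 * (G F m + G F N) := by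
      simp [jumpCost, kappa, Set.indicator_of_notMem hbd, hm, hN]
    rw [hκ]
    obtain ⟨ρ₁, hρ₁, hval⟩ := D.exists_forall_mem_valid hs hbd
    obtain ⟨ρ, hρ, hρ1, hρ2⟩ : ∃ ρ > 0, ρ ≤ ρ₀ ∧ ρ ≤ ρ₁ :=
      ⟨min ρ₀ ρ₁, lt_min hρ₀ hρ₁, min_le_left _ _, min_le_right _ _⟩
    have hv' (t : ℝ) (h1 : s - ρ < t) (h2 : t < s + ρ) : t ∈ D.valid :=
      hval t (abs_lt.2 ⟨by linarith, by linarith⟩)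
    obtain ⟨α, hα, hα1⟩ := classA₀.exists_eq_one hΞ (s := s - ρ / 2) (t := s - ρ / 4)
      (by linarith) fun t ht => hv' t (by linarith [ht.1]) (by linarith [ht.2])
    obtain ⟨β, hβ, hβ1⟩ := classA₀.exists_eq_one hΞ (s := s + ρ / 4) (t := s + ρ / 2)
      (by linarith) fun t ht => hv' t (by linarith [ht.1]) (by linarith [ht.2])
    filter_upwards [h.eventually_exists_lift hF hs hmm (ρ := ρ / 4) (by positivity) hr6,
      h.eventually_exists_lift hF hs hNm (ρ := ρ / 4) (by positivity) hr6,
      h.eventually_abs_primG_lt hF hΞ.1.1 hα1 hr6, h.eventually_abs_primG_lt hF hΞ.1.1 hβ1 hr6,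
      Ioo_mem_nhdsGT one_pos]
      with ε ⟨p, hp, hps, hpm⟩ ⟨q, hq, hqs, hqN⟩ ha hb hε
    have hαv : α ∈ D.valid := hv' α (by linarith [hα.1]) (by linarith [hα.2])
    have hβv : β ∈ D.valid := hv' β (by linarith [hβ.1]) (by linarith [hβ.2])
    rw [abs_lt] at hps hqs hpm hqN ha hb
    have hin : ∀ w ∈ Set.Ioc α β, D.param w ∈ U :=
      fun w hw => hρ₀U w (abs_lt.2 ⟨by linarith [hw.1, hα.1], by linarith [hw.2, hβ.2]⟩)
    rcases le_total p q with hpq | hpq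
    · refine (ENNReal_ofReal_le_add_of_sub_le ?_ (ofReal_chain_le_localEnergy hF hε.1 (hv ε hε)
        hU hαv (by linarith [hα.2]) hpq (by linarith [hβ.1]) hβv (by linarith [hα.1, hβ.2])
        hin)).trans (add_le_add le_rfl hrη)
      have h1 := le_abs_self (primG F (v ε (D.param q)) - primG F (v ε (D.param p)))
      have h2 := neg_le_abs (primG F (v ε (D.param p)) - primG F (v ε (D.param α)))
      have h3 := neg_le_abs (primG F (v ε (D.param β)) - primG F (v ε (D.param q)))
      linarith
    · refine (ENNReal_ofReal_le_add_of_sub_le ?_ (ofReal_chain_le_localEnergy hF hε.1 (hv ε hε)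
        hU hαv (by linarith [hα.2]) hpq (by linarith [hβ.1]) hβv (by linarith [hα.1, hβ.2])
        hin)).trans (add_le_add le_rfl hrη)
      have h1 := neg_le_abs (primG F (v ε (D.param p)) - primG F (v ε (D.param q)))
      have h2 := le_abs_self (primG F (v ε (D.param q)) - primG F (v ε (D.param α)))
      have h3 := le_abs_self (primG F (v ε (D.param β)) - primG F (v ε (D.param p)))
      linarith

/-! ### Compactness: the limit belongs to 𝓐₀ -/

/-- If the energies stay bounded along a sequence, the limit contains the constant `1`. -/
lemma one_mem_of_liminf_lt_top {D : Domain} {F : ℝ → ℝ} (hF : CondF1 F)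
    {v : ℝ → C(D.Pt, ℝ)} (hv : ∀ ε ∈ Set.Ioo (0 : ℝ) 1, MemH1 D (v ε))
    {Ξ : D.Pt → Set ℝ} (hΞ : Ξ ∈ classB D.Pt) (h : GraphTendsto v Ξ) {C : ℝ}
    (hC : ∃ᶠ ε in 𝓝[>] (0 : ℝ), energy D F ε (v ε) ≤ C) (x : D.Pt) : (1 : ℝ) ∈ Ξ x := by
  refine h.mem_of_frequently hΞ fun ρ hρ => ?_
  obtain ⟨R, hR⟩ := h.exists_bound hΞ
  have hK : IsCompact (Set.Icc (-R) R ∩ {y | ρ ≤ |y - 1|}) :=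
    isCompact_Icc.inter_right (isClosed_le continuous_const (by fun_prop))
  -- F has a positive lower bound at bounded distance from 0 and at distance at least ρ from its
  -- only zero.
  obtain ⟨m, hm, hmF⟩ := hK.exists_forall_le' (a := 0) hF.1.continuousOn fun y hy =>
    (hF.2.1 y).lt_of_ne fun h0 => by
      have : y = 1 := (hF.2.2 y).1 h0.symm
      have h2 : ρ ≤ |y - 1| := hy.2
      rw [this, sub_self, abs_zero] at h2
      linarith
  obtain ⟨s, hs, rfl⟩ := D.exists_rep x
  obtain ⟨t, u, htu, hval, hd⟩ := D.exists_Icc_subset_valid hs (lt_min hρ (half_pos one_pos))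
  have hC1 : 0 < |C| + 1 := by positivity
  -- Below this threshold the potential term alone, m(u - t)/(2ε), exceeds |C| + 1.
  have hsmall : ∀ᶠ ε in 𝓝[>] (0 : ℝ), ε < m * (u - t) / (2 * (|C| + 1)) := by
    refine nhdsWithin_le_nhds (Iio_mem_nhds ?_)
    have := sub_pos.2 htu
    positivity
  refine (hC.and_eventually (hR.and (hsmall.and (Ioo_mem_nhdsGT one_pos)))).mono ?_
  rintro ε ⟨hεC, hεR, hεs, hε⟩
  by_contra! hcon
  have hεpos := hε.1
  have hlow : ENNReal.ofReal (1 / (2 * ε) * m) * ENNReal.ofReal (u - t) ≤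
      localEnergy D F ε (v ε) (Metric.ball (D.param s) ρ) := by
    have hd1 := (abs_lt.1 (hd t ⟨le_rfl, htu.le⟩))
    have hd2 := (abs_lt.1 (hd u ⟨htu.le, le_rfl⟩))
    have hmin := min_le_right ρ (1 / 2 : ℝ)
    have hball (y : ℝ) (hy : y ∈ Set.Ioc t u) : D.param y ∈ Metric.ball (D.param s) ρ :=
      (D.dist_param_le _ _).trans_lt
        ((hd y (Set.Ioc_subset_Icc_self hy)).trans_le (min_le_left _ _))
    refine le_trans ?_ (setLIntegral_density_le D F ε (v ε) (hval ⟨le_rfl, htu.le⟩)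
      (hval ⟨htu.le, le_rfl⟩) (Or.inl (by linarith))
      (Metric.isOpen_ball.preimage D.continuous_param).measurableSet hball)
    rw [← Real.volume_Ioc, ← setLIntegral_const]
    refine setLIntegral_mono' measurableSet_Ioc fun y hy => ENNReal.ofReal_le_ofReal ?_
    have h1 : m ≤ F (v ε (D.param y)) :=
      hmF _ ⟨abs_le.1 (hεR _), hcon _ (hball y hy)⟩
    have h2 : 1 / (2 * ε) * m ≤ 1 / (2 * ε) * F (v ε (D.param y)) := by gcongr
    have h3 : 0 ≤ ε / 2 * |deriv (fun x => v ε (D.param x)) y| ^ 2 := by positivity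
    linarith
  have hup := hlow.trans (localEnergy_le hF hεpos (hv ε hε) _)
  rw [← ENNReal.ofReal_mul (by positivity),
    ENNReal.ofReal_le_ofReal_iff (energy_nonneg hF hεpos _)] at hup
  have h4 : 1 / (2 * ε) * m * (u - t) ≤ |C| := hup.trans (hεC.trans (le_abs_self C))
  rw [lt_div_iff₀ (by positivity)] at hεs
  have h5 : 1 / (2 * ε) * m * (u - t) * (2 * ε) = m * (u - t) := by field_simp
  nlinarith

lemma exists_frequently_energy_le {D : Domain} {F : ℝ → ℝ} {a : D.Pt} {b : ℝ}
    (hb : 0 ≤ b) {v : ℝ → C(D.Pt, ℝ)}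
    (hfin : liminf (fun ε => ENNReal.ofReal (energyB D F a b ε (v ε))) (𝓝[>] 0) < ⊤) :
    ∃ C, ∃ᶠ ε in 𝓝[>] (0 : ℝ), energy D F ε (v ε) ≤ C := by
  obtain ⟨C, hC1, hC2⟩ := ENNReal.lt_iff_exists_nnreal_btwn.1 hfin
  refine ⟨C, (frequently_lt_of_liminf_lt (by isBoundedDefault) hC1).mono fun ε hε => ?_⟩
  refine (energy_le_energyB (a := a) hb _ _).trans ?_
  rw [← ENNReal.ofReal_coe_nnreal] at hε
  exact (ENNReal.ofReal_le_ofReal_iff C.2).1 hε.le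

/-- Values of the limit are intervals, by the intermediate value theorem. -/
lemma GraphTendsto.ordConnected {D : Domain} {v : ℝ → C(D.Pt, ℝ)} {Ξ : D.Pt → Set ℝ}
    (h : GraphTendsto v Ξ) (hΞ : Ξ ∈ classB D.Pt) (x : D.Pt) : (Ξ x).OrdConnected := by
  refine ⟨fun y hy z hz w hw => ?_⟩
  rcases hw.1.eq_or_lt with rfl | h1
  · exact hy
  rcases hw.2.eq_or_lt with rfl | h2
  · exact hz
  refine h.mem_of_frequently hΞ fun ρ hρ => Eventually.frequently ?_
  obtain ⟨s, hs, rfl⟩ := D.exists_rep x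
  -- Errors below w - y and z - w make the two values straddle w.
  filter_upwards [h.eventually_exists_near hy (lt_min hρ (sub_pos.2 h1)),
    h.eventually_exists_near hz (lt_min hρ (sub_pos.2 h2))]
    with ε ⟨p, hp, hpy⟩ ⟨q, hq, hqz⟩
  obtain ⟨t, ht, rfl, htd⟩ := D.exists_lift hs p
  obtain ⟨u, hu, rfl, hud⟩ := D.exists_lift hs q
  have ht1 := abs_lt.1 (htd.trans_lt (hp.trans_le (min_le_left _ _)))
  have hu1 := abs_lt.1 (hud.trans_lt (hq.trans_le (min_le_left _ _)))
  have hp1 := abs_lt.1 (hpy.trans_le (min_le_right _ _))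
  have hq1 := abs_lt.1 (hqz.trans_le (min_le_right _ _))
  have hcont : Continuous fun t => v ε (D.param t) := (v ε).continuous.comp D.continuous_param
  obtain ⟨c, hc, hcw⟩ := intermediate_value_uIcc (a := t) (b := u) hcont.continuousOn
    (Set.Icc_subset_uIcc (a := v ε (D.param t)) (b := v ε (D.param u))
      (⟨by linarith, by linarith⟩ : w ∈ Set.Icc _ _))
  refine ⟨D.param c, (D.dist_param_le _ _).trans_lt (abs_lt.2 ?_), by simpa [hcw] using hρ⟩
  rw [Set.mem_uIcc] at hc
  rcases hc with hc | hc <;> constructor <;> linarith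

/-- Countability needs only the crude cost G(y) of a single value y ≠ 1, since both y and 1 are
approached near x. The full jump cost would presuppose membership in 𝓐₀. A finite sum in [0, ∞] has
countable support. -/
lemma mem_classA₀_of_liminf_lt_top {D : Domain} {F : ℝ → ℝ} (hF : CondF1 F) {a : D.Pt} {b : ℝ}
    (hb : 0 ≤ b) {v : ℝ → C(D.Pt, ℝ)} (hv : ∀ ε ∈ Set.Ioo (0 : ℝ) 1, MemH1 D (v ε))
    {Ξ : D.Pt → Set ℝ} (hΞ : Ξ ∈ classB D.Pt) (h : GraphTendsto v Ξ)
    (hfin : liminf (fun ε => ENNReal.ofReal (energyB D F a b ε (v ε))) (𝓝[>] 0) < ⊤) :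
    Ξ ∈ classA₀ D.Pt := by
  obtain ⟨C, hC⟩ := exists_frequently_energy_le hb hfin
  have hone := one_mem_of_liminf_lt_top hF hv hΞ h hC
  refine ⟨⟨hΞ, fun x => ?_⟩, ?_⟩
  · have hcpt := classB.isCompact hΞ x
    have hne : (Ξ x).Nonempty := ⟨1, hone x⟩
    refine ⟨sInf (Ξ x), sSup (Ξ x), csInf_le_csSup hne hcpt.bddBelow hcpt.bddAbove, ?_⟩
    refine subset_antisymm (fun y hy => ⟨csInf_le hcpt.bddBelow hy, le_csSup hcpt.bddAbove hy⟩) ?_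
    exact (h.ordConnected hΞ x).out (hcpt.sInf_mem hne) (hcpt.sSup_mem hne)
  · have hex (x : D.Pt) : ∃ y ∈ Ξ x, Ξ x ≠ {1} → y ≠ 1 := by
      by_cases hx : Ξ x = {1}
      · exact ⟨1, hone x, fun h => absurd hx h⟩
      · by_contra! hcon
        exact hx (Set.eq_singleton_iff_unique_mem.2 ⟨hone x, fun y hy => (hcon y hy).2⟩)
    choose y hy hy1 using hex
    have hle := tsum_add_le_liminf hF hb hv (a := a) (fun x => ENNReal.ofReal (G F (y x))) 0
      (fun x U hU hx η hη => by
        have := eventually_ofReal_abs_le hF hv h (hy x) (hone x) hU hx hη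
        simpa [abs_primG] using this) (fun _ _ => Eventually.of_forall fun _ => zero_le)
    rw [add_zero] at hle
    refine (Summable.countable_support_ennreal (hle.trans_lt hfin).ne).mono fun x hx => ?_
    simpa using G_pos hF (hy1 x hx)

/-! ### The liminf inequality -/

lemma limitEnergy_le_tsum {D : Domain} {F : ℝ → ℝ} {Ξ : D.Pt → Set ℝ}
    (hΞ : Ξ ∈ classA₀ D.Pt) :
    limitEnergy D F Ξ ≤ ∑' x, ENNReal.ofReal (jumpCost D F Ξ x) := by
  rw [limitEnergy_eq hΞ]
  exact ENNReal.tsum_comp_le_tsum_of_injective Subtype.val_injective _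

/-- The limit values at a only bound v_ε(a) from below up to a small error; squaring respects this
bound because the minimum is nonnegative. -/
lemma eventually_ofReal_mul_sq_le {D : Domain} {a : D.Pt} {b : ℝ} (hb : 0 ≤ b)
    {v : ℝ → C(D.Pt, ℝ)} {Ξ : D.Pt → Set ℝ} (hΞ : Ξ ∈ classB D.Pt) (h : GraphTendsto v Ξ)
    (hsgn : b = 0 ∨ 0 ≤ sInf (Ξ a)) {η : ℝ≥0∞} (hη : 0 < η) :
    ∀ᶠ ε in 𝓝[>] (0 : ℝ),
      ENNReal.ofReal (b * sInf (Ξ a) ^ 2) ≤ ENNReal.ofReal (b * v ε a ^ 2) + η := by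
  rcases hsgn with rfl | hm
  · simp
  obtain ⟨r, hr, hrη⟩ := exists_ofReal_le hη
  have hopen : IsOpen {z : ℝ | b * sInf (Ξ a) ^ 2 - r < b * z ^ 2} :=
    isOpen_lt continuous_const (by fun_prop)
  have hsub : Ξ a ⊆ {z : ℝ | b * sInf (Ξ a) ^ 2 - r < b * z ^ 2} := fun z hz => by
    have hz1 : sInf (Ξ a) ≤ z := csInf_le (classB.isCompact hΞ a).bddBelow hz
    have : b * sInf (Ξ a) ^ 2 ≤ b * z ^ 2 := by gcongr
    change b * sInf (Ξ a) ^ 2 - r < b * z ^ 2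
    linarith
  filter_upwards [h.eventually_mem hΞ hopen hsub] with ε hε
  exact (ENNReal_ofReal_le_add_of_sub_le (le_of_lt hε) le_rfl).trans (add_le_add le_rfl hrη)

lemma limitEnergyB_le_liminf {D : Domain} {F : ℝ → ℝ} (hF : CondF1 F) {a : D.Pt} {b : ℝ}
    (hb : 0 ≤ b) {v : ℝ → C(D.Pt, ℝ)} (hv : ∀ ε ∈ Set.Ioo (0 : ℝ) 1, MemH1 D (v ε))
    {Ξ : D.Pt → Set ℝ} (hΞ : Ξ ∈ classB D.Pt) (h : GraphTendsto v Ξ)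
    (hsgn : b = 0 ∨ 0 ≤ sInf (Ξ a)) :
    limitEnergyB D F a b Ξ ≤
      liminf (fun ε => ENNReal.ofReal (energyB D F a b ε (v ε))) (𝓝[>] 0) := by
  by_cases hfin : liminf (fun ε => ENNReal.ofReal (energyB D F a b ε (v ε))) (𝓝[>] 0) < ⊤
  · have hΞ₀ := mem_classA₀_of_liminf_lt_top hF hb hv hΞ h hfin
    refine (add_le_add_left (limitEnergy_le_tsum hΞ₀) _).trans ?_
    exact tsum_add_le_liminf hF hb hv _ _
      (fun x U hU hx η hη => eventually_ofReal_jumpCost_le hF hv hΞ₀ h x hU hx hη)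
      (fun η hη => eventually_ofReal_mul_sq_le hb hΞ h hsgn hη)
  · rw [not_lt_top_iff.1 hfin]
    exact le_top

/-! ### The profile of a transition -/

/-- `q` is a global increasing solution of `q' = √(H(q))` with `q 0 = 1`. -/
structure IsProfile (H q : ℝ → ℝ) : Prop where
  zero : q 0 = 1
  strictMono : StrictMono q
  surjective : Function.Surjective q
  hasDerivAt : ∀ t, HasDerivAt q (√(H (q t))) t

/-- Separation of variables: q inverts T(y) = ∫₁ʸ 1/√H. The bound on H makes T grow at least
linearly in both directions, so T is onto ℝ and q is global. -/
lemma exists_isProfile {H : ℝ → ℝ} (hH : Continuous H) (hpos : ∀ y, 0 < H y) {C : ℝ}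
    (hC : ∀ y, H y ≤ C) : ∃ q, IsProfile H q := by
  have hC0 : 0 < C := (hpos 0).trans_le (hC 0)
  have hs (y : ℝ) : 0 < √(H y) := Real.sqrt_pos.2 (hpos y)
  have hc : Continuous fun y => (√(H y))⁻¹ := hH.sqrt.inv₀ fun y => (hs y).ne'
  set T : ℝ → ℝ := fun y => ∫ τ in (1 : ℝ)..y, (√(H τ))⁻¹ with hT
  have hd (y : ℝ) : HasDerivAt T (√(H y))⁻¹ y :=
    intervalIntegral.integral_hasDerivAt_right (hc.intervalIntegrable _ _)
      (hc.stronglyMeasurableAtFilter _ _) hc.continuousAt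
  have hmono : StrictMono T := strictMono_of_deriv_pos fun y => by
    rw [(hd y).deriv]; exact inv_pos.2 (hs y)
  set k := (√C)⁻¹
  have hk : 0 < k := inv_pos.2 (Real.sqrt_pos.2 hC0)
  have hmono2 : Monotone fun y => T y - k * y := by
    have hd2 (y : ℝ) : HasDerivAt (fun y => T y - k * y) ((√(H y))⁻¹ - k) y := by
      simpa using (hd y).fun_sub ((hasDerivAt_id y).const_mul k)
    refine monotone_of_deriv_nonneg (fun y => (hd2 y).differentiableAt) fun y => ?_
    rw [(hd2 y).deriv, sub_nonneg]
    exact inv_anti₀ (hs y) (Real.sqrt_le_sqrt (hC y))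
  have htop : Tendsto T atTop atTop := by
    refine tendsto_atTop_mono' atTop (f₁ := fun y => k * y + (T 0 - k * 0)) ?_
      (tendsto_atTop_add_const_right _ _ (tendsto_id.const_mul_atTop hk))
    filter_upwards [eventually_ge_atTop 0] with y hy
    have : T 0 - k * 0 ≤ T y - k * y := hmono2 hy
    linarith
  have hbot : Tendsto T atBot atBot := by
    refine tendsto_atBot_mono' atBot (f₁ := fun y => k * y + (T 0 - k * 0)) ?_
      (tendsto_atBot_add_const_right _ _ (tendsto_id.const_mul_atBot hk))
    filter_upwards [eventually_le_atBot 0] with y hy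
    have : T y - k * y ≤ T 0 - k * 0 := hmono2 hy
    linarith
  have hsurj : Function.Surjective T :=
    (continuous_iff_continuousAt.2 fun y => (hd y).continuousAt).surjective htop hbot
  set e : ℝ ≃o ℝ := hmono.orderIsoOfSurjective T hsurj
  have he (y : ℝ) : e y = T y := rfl
  refine ⟨e.symm, ?_, e.symm.strictMono, e.symm.surjective, fun t => ?_⟩
  · rw [OrderIso.symm_apply_eq, he]
    simp [hT]
  · have := HasDerivAt.of_local_left_inverse (f := T) (g := e.symm) (a := t)
      e.symm.continuous.continuousAt (hd (e.symm t)) (inv_pos.2 (hs _)).ne'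
      (Eventually.of_forall fun y => by rw [← he, OrderIso.apply_symm_apply])
    rwa [inv_inv] at this

lemma IsProfile.lipschitzWith {H q : ℝ → ℝ} (hq : IsProfile H q) {C : ℝ} (hC : ∀ y, H y ≤ C) :
    LipschitzWith (Real.toNNReal √C) q := by
  refine lipschitzWith_of_nnnorm_deriv_le (fun t => (hq.hasDerivAt t).differentiableAt)
    fun t => ?_
  rw [(hq.hasDerivAt t).deriv, ← NNReal.coe_le_coe, coe_nnnorm, Real.norm_eq_abs,
    abs_of_nonneg (Real.sqrt_nonneg _), Real.coe_toNNReal _ (Real.sqrt_nonneg _)]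
  exact Real.sqrt_le_sqrt (hC _)

/-- This is √(F + δ) ≤ √F + √δ, integrated from 1 to ξ. -/
lemma G_le_of_perturb {F H : ℝ → ℝ} (hF : Continuous F) (hF0 : ∀ y, 0 ≤ F y) (hH : Continuous H)
    {δ ξ : ℝ} (hδ : 0 ≤ δ) (h : ∀ y ∈ Set.uIcc 1 ξ, H y = F y + δ) :
    G H ξ ≤ G F ξ + √δ * |ξ - 1| := by
  have hdiff : primG H ξ - primG F ξ = ∫ τ in (1 : ℝ)..ξ, (√(H τ) - √(F τ)) :=
    (intervalIntegral.integral_sub (hH.sqrt.intervalIntegrable _ _)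
      (hF.sqrt.intervalIntegrable _ _)).symm
  have hb : |primG H ξ - primG F ξ| ≤ √δ * |ξ - 1| := by
    rw [hdiff, ← Real.norm_eq_abs]
    refine intervalIntegral.norm_integral_le_of_norm_le_const fun y hy => ?_
    have h1 := h y (Set.uIoc_subset_uIcc hy)
    rw [h1, Real.norm_eq_abs, abs_of_nonneg
      (sub_nonneg.2 (Real.sqrt_le_sqrt (by linarith))), sub_le_iff_le_add, add_comm]
    refine Real.sqrt_le_iff.2 ⟨by positivity, ?_⟩
    nlinarith [Real.sq_sqrt (hF0 y), Real.sq_sqrt hδ, Real.sqrt_nonneg (F y), Real.sqrt_nonneg δ]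
  have := abs_sub_abs_le_abs_sub (primG H ξ) (primG F ξ)
  rw [abs_primG, abs_primG] at this
  linarith

/-- The sign of a real number, with value `1` at `0`. -/
noncomputable def signOf (τ : ℝ) : ℝ := if 0 ≤ τ then 1 else -1

lemma signOf_mul_abs (τ : ℝ) : signOf τ * |τ| = τ := by
  unfold signOf
  split_ifs with h
  · rw [abs_of_nonneg h, one_mul]
  · rw [abs_of_neg (not_le.1 h)]; ring

lemma abs_signOf (τ : ℝ) : |signOf τ| = 1 := by
  unfold signOf
  split_ifs <;> simp

lemma signOf_sq (τ : ℝ) : signOf τ * signOf τ = 1 := by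
  unfold signOf
  split_ifs <;> simp

/-- The profile at distance `d` from the centre of a bump of height `q τ`. -/
noncomputable def bumpAt (q : ℝ → ℝ) (τ ε d : ℝ) : ℝ := q (signOf τ * max (|τ| - d / ε) 0)

lemma bumpAt_zero (q : ℝ → ℝ) (τ ε : ℝ) : bumpAt q τ ε 0 = q τ := by
  rw [bumpAt, zero_div, sub_zero, max_eq_left (abs_nonneg _), signOf_mul_abs]

lemma bumpAt_of_le {H q : ℝ → ℝ} (hq : IsProfile H q) {τ ε d : ℝ} (hε : 0 < ε)
    (hd : ε * |τ| ≤ d) : bumpAt q τ ε d = 1 := by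
  have : |τ| ≤ d / ε := by rw [le_div_iff₀ hε]; linarith
  rw [bumpAt, max_eq_right (by linarith), mul_zero, hq.zero]

lemma bumpAt_of_ge {q : ℝ → ℝ} {τ ε d : ℝ} (hε : 0 < ε) (hd : d ≤ ε * |τ|) :
    bumpAt q τ ε d = q (signOf τ * (|τ| - d / ε)) := by
  have : d / ε ≤ |τ| := by rw [div_le_iff₀ hε]; linarith
  rw [bumpAt, max_eq_left (by linarith)]

lemma bumpAt_mem_uIcc {H q : ℝ → ℝ} (hq : IsProfile H q) {τ ε d : ℝ} (hε : 0 < ε)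
    (hd : 0 ≤ d) : bumpAt q τ ε d ∈ Set.uIcc 1 (q τ) := by
  have h1 : 0 ≤ max (|τ| - d / ε) 0 := le_max_right _ _
  have h2 : max (|τ| - d / ε) 0 ≤ |τ| :=
    max_le (by linarith [div_nonneg hd hε.le]) (abs_nonneg _)
  rw [← hq.zero, bumpAt, Set.mem_uIcc]
  have hm := hq.strictMono.monotone
  by_cases h : 0 ≤ τ
  · left
    rw [abs_of_nonneg h] at h2 ⊢
    simp only [signOf, if_pos h, one_mul]
    rw [abs_of_nonneg h] at h1
    exact ⟨hm h1, hm h2⟩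
  · right
    have h3 := abs_of_neg (not_le.1 h)
    simp only [signOf, if_neg h]
    exact ⟨hm (by linarith), hm (by linarith)⟩

lemma exists_bumpAt_eq {H q : ℝ → ℝ} (hq : IsProfile H q) (hqc : Continuous q) {τ ε z : ℝ}
    (hε : 0 < ε) (hz : z ∈ Set.uIcc 1 (q τ)) :
    ∃ d ∈ Set.Icc 0 (ε * |τ|), bumpAt q τ ε d = z := by
  have hc : Continuous (bumpAt q τ ε) := by unfold bumpAt; fun_prop
  have h0 : 0 ≤ ε * |τ| := by positivity
  have := intermediate_value_uIcc (a := 0) (b := ε * |τ|) (f := bumpAt q τ ε) hc.continuousOn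
  rw [bumpAt_zero, bumpAt_of_le hq hε le_rfl, Set.uIcc_comm, Set.uIcc_of_le h0] at this
  exact this hz

lemma lipschitzWith_bumpAt {q : ℝ → ℝ} {K : NNReal} (hq : LipschitzWith K q) (τ : ℝ) {ε : ℝ}
    (hε : 0 < ε) : LipschitzWith (K * Real.toNNReal ε⁻¹) (bumpAt q τ ε) := by
  refine hq.comp (LipschitzWith.of_dist_le_mul fun d d' => ?_)
  rw [Real.coe_toNNReal _ (inv_pos.2 hε).le, Real.dist_eq, Real.dist_eq, ← mul_sub, abs_mul,
    abs_signOf, one_mul]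
  refine (abs_max_sub_max_le_abs _ _ _).trans (le_of_eq ?_)
  rw [show |τ| - d / ε - (|τ| - d' / ε) = ε⁻¹ * (d' - d) by field_simp; ring, abs_mul,
    abs_of_pos (inv_pos.2 hε), abs_sub_comm]

/-- The one-sided energy density of a bump. -/
noncomputable def bumpDensity (H q : ℝ → ℝ) (τ ε : ℝ) : ℝ → ℝ≥0∞ :=
  (Set.Ioo 0 (ε * |τ|)).indicator fun d =>
    ENNReal.ofReal (H (q (signOf τ * (|τ| - d / ε))) / ε)

/-- Since q' = √H and the derivative of `primG H` is also √H, the density is an exact derivative of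
∓`primG H` along the profile, which vanishes at the outer end where q = 1. -/
lemma lintegral_bumpDensity_le {H q : ℝ → ℝ} (hq : IsProfile H q) (hH : Continuous H)
    (hH0 : ∀ y, 0 ≤ H y) {τ ε : ℝ} (hε : 0 < ε) :
    ∫⁻ d, bumpDensity H q τ ε d ≤ ENNReal.ofReal (G H (q τ)) := by
  have hqc : Continuous q := continuous_iff_continuousAt.2 fun t => (hq.hasDerivAt t).continuousAt
  have hc : Continuous fun d => H (q (signOf τ * (|τ| - d / ε))) / ε := by fun_prop
  have h0 : 0 ≤ ε * |τ| := by positivity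
  rw [bumpDensity, lintegral_indicator measurableSet_Ioo]
  rw [← ofReal_integral_eq_lintegral_ofReal
    ((hc.integrableOn_Icc (a := 0) (b := ε * |τ|)).mono_set Set.Ioo_subset_Icc_self)
    (ae_of_all _ fun d => div_nonneg (hH0 _) hε.le)]
  apply ENNReal.ofReal_le_ofReal
  rw [← integral_Ioc_eq_integral_Ioo, ← intervalIntegral.integral_of_le h0]
  have hd (d : ℝ) : HasDerivAt
      (fun d => -signOf τ * primG H (q (signOf τ * (|τ| - d / ε))))
      (H (q (signOf τ * (|τ| - d / ε))) / ε) d := by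
    set t := signOf τ * (|τ| - d / ε)
    have h1 : HasDerivAt (fun d => signOf τ * (|τ| - d / ε)) (signOf τ * -(1 / ε)) d := by
      simpa using (((hasDerivAt_id d).div_const ε).const_sub |τ|).const_mul (signOf τ)
    have h2 : HasDerivAt (fun d => q (signOf τ * (|τ| - d / ε)))
        (√(H (q t)) * (signOf τ * -(1 / ε))) d := (hq.hasDerivAt t).comp d h1
    have h3 := ((hasDerivAt_primG hH (q t)).comp d h2).const_mul (-signOf τ)
    have h4 := signOf_sq τ
    have h5 := Real.mul_self_sqrt (hH0 (q t))
    have h6 : -signOf τ * (√(H (q t)) * (√(H (q t)) * (signOf τ * -(1 / ε)))) = H (q t) / ε := by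
      calc _ = (√(H (q t)) * √(H (q t))) * (signOf τ * signOf τ) / ε := by ring
        _ = _ := by rw [h5, h4, mul_one]
    rw [h6] at h3
    exact h3
  rw [intervalIntegral.integral_eq_sub_of_hasDerivAt (fun d _ => hd d)
    (hc.intervalIntegrable _ _)]
  have e1 : ε * |τ| / ε = |τ| := by field_simp
  rw [e1, sub_self, mul_zero, hq.zero, primG_one, zero_div, sub_zero, signOf_mul_abs, mul_zero,
    zero_sub, neg_mul, neg_neg, ← abs_primG]
  refine (le_abs_self _).trans (le_of_eq ?_)
  rw [abs_mul, abs_signOf, one_mul]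

/-- The density of a function which near `x` is a bump around `s`. -/
lemma ofReal_density_bump_le {F H q : ℝ → ℝ} (hF : CondF1 F) (hq : IsProfile H q)
    (hH0 : ∀ y, 0 ≤ H y) {τ ε s x : ℝ} (hε : 0 < ε)
    (hFH : ∀ y ∈ Set.uIcc 1 (q τ), F y ≤ H y) {f : ℝ → ℝ}
    (hf : f =ᶠ[𝓝 x] fun x => bumpAt q τ ε |x - s|) (hxs : x ≠ s) (hxτ : |x - s| ≠ ε * |τ|) :
    ENNReal.ofReal (ε / 2 * |deriv f x| ^ 2 + 1 / (2 * ε) * F (f x)) ≤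
      bumpDensity H q τ ε |x - s| := by
  rw [hf.deriv_eq, hf.eq_of_nhds]
  have hcabs : Continuous fun x => |x - s| := by fun_prop
  rcases lt_or_gt_of_ne hxτ with hlt | hgt
  · have hloc : (fun x => bumpAt q τ ε |x - s|) =ᶠ[𝓝 x]
        fun x => q (signOf τ * (|τ| - |x - s| / ε)) := by
      filter_upwards [hcabs.continuousAt.eventually_lt continuousAt_const hlt] with y hy
      exact bumpAt_of_ge hε hy.le
    have hmem : bumpAt q τ ε |x - s| ∈ Set.uIcc 1 (q τ) := bumpAt_mem_uIcc hq hε (abs_nonneg _)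
    have hFle := hFH _ hmem
    rw [hloc.deriv_eq]
    rw [hloc.eq_of_nhds] at hFle ⊢
    have hin : |x - s| ∈ Set.Ioo 0 (ε * |τ|) := ⟨abs_pos.2 (sub_ne_zero.2 hxs), hlt⟩
    rw [bumpDensity, Set.indicator_of_mem hin]
    apply ENNReal.ofReal_le_ofReal
    set t := signOf τ * (|τ| - |x - s| / ε)
    -- Away from s the distance has slope ±1, and only the square of the slope enters the density.
    obtain ⟨κ, hκ, hκ1⟩ : ∃ κ : ℝ, HasDerivAt (fun x => |x - s|) κ x ∧ |κ| = 1 := by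
      rcases lt_or_gt_of_ne (sub_ne_zero.2 hxs) with h | h
      · exact ⟨-1, by simpa [Function.comp_def] using
          (hasDerivAt_abs_neg h).comp x ((hasDerivAt_id x).sub_const s), by simp⟩
      · exact ⟨1, by simpa [Function.comp_def] using
          (hasDerivAt_abs_pos h).comp x ((hasDerivAt_id x).sub_const s), by simp⟩
    have h1 : HasDerivAt (fun x => signOf τ * (|τ| - |x - s| / ε)) (signOf τ * -(κ / ε)) x := by
      simpa using ((hκ.div_const ε).const_sub |τ|).const_mul (signOf τ)
    have h2 : HasDerivAt (fun x => q (signOf τ * (|τ| - |x - s| / ε)))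
        (√(H (q t)) * (signOf τ * -(κ / ε))) x := (hq.hasDerivAt t).comp x h1
    rw [h2.deriv, abs_mul, abs_mul, abs_signOf, abs_neg, abs_div, hκ1, abs_of_pos hε,
      abs_of_nonneg (Real.sqrt_nonneg _), mul_pow, Real.sq_sqrt (hH0 _)]
    -- The gradient part is exactly H/(2ε) and the potential part at most that.
    calc ε / 2 * (H (q t) * (1 * (1 / ε)) ^ 2) + 1 / (2 * ε) * F (q t)
        ≤ ε / 2 * (H (q t) * (1 * (1 / ε)) ^ 2) + 1 / (2 * ε) * H (q t) := by gcongr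
      _ = H (q t) / ε := by field_simp; ring
  · have hloc : (fun x => bumpAt q τ ε |x - s|) =ᶠ[𝓝 x] fun _ => (1 : ℝ) := by
      filter_upwards [continuousAt_const.eventually_lt hcabs.continuousAt hgt] with y hy
      exact bumpAt_of_le hq hε hy.le
    rw [hloc.deriv_eq, hloc.eq_of_nhds]
    simp [(hF.2.2 1).2 rfl]

/-! ### A single bump on M -/

lemma memH1_of_lipschitzWith {D : Domain} {K : NNReal} {w : C(D.Pt, ℝ)}
    (hw : LipschitzWith K w) : MemH1 D w := by
  have hl : LipschitzWith K fun x => w (D.param x) := by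
    simpa using! hw.comp D.lipschitzWith_param
  refine ⟨(hl.lipschitzOnWith (s := Set.uIcc D.left D.right)).absolutelyContinuousOnInterval, ?_⟩
  exact MemLp.of_bound (measurable_deriv _).aestronglyMeasurable K
    (ae_of_all _ fun x => norm_deriv_le_of_lipschitz hl)

lemma measurable_density {D : Domain} {F : ℝ → ℝ} (hF : Continuous F) (ε : ℝ)
    (v : C(D.Pt, ℝ)) : Measurable (density D F ε v) := by
  have h1 : Measurable fun x => F (v (D.param x)) :=
    (hF.comp (v.continuous.comp D.continuous_param)).measurable
  have h2 : Measurable (deriv fun x => v (D.param x)) := measurable_deriv _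
  have h3 : Measurable fun x => |deriv (fun x => v (D.param x)) x| := h2.abs
  exact (((h3.pow_const 2).const_mul _).add (h1.const_mul _)).ennreal_ofReal

lemma setLIntegral_density_circle (F : ℝ → ℝ) (ε : ℝ) (v : C(Domain.circle.Pt, ℝ)) (u : ℝ) :
    ∫⁻ x in Set.Ioc 0 1, density Domain.circle F ε v x =
      ∫⁻ x in Set.Ioc u (u + 1), density Domain.circle F ε v x := by
  have hper := density_circle_periodic F ε v
  have key (u : ℝ) : ∫⁻ x in Set.Ioc u (u + 1), density Domain.circle F ε v x =
      ∫⁻ b : UnitAddCircle, hper.lift b :=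
    UnitAddCircle.lintegral_preimage u hper.lift
  rw [key, ← key 0, zero_add]

/-- A parameter interval covering `M` once, on which the distance to `c` is the distance of
parameters. -/
lemma Domain.exists_chart (D : Domain) (c : D.Pt) : ∃ A B s : ℝ,
    (∀ x ∈ Set.Icc A B, dist (D.param x) c = |x - s|) ∧ (c ∈ D.boundary → s ≤ A ∨ B ≤ s) ∧
    ∀ F ε v, ∫⁻ x in Set.Ioc D.left D.right, density D F ε v x =
      ∫⁻ x in Set.Ioc A B, density D F ε v x := by
  cases D with
  | interval l r h =>
    refine ⟨l, r, (c : Set.Icc l r).1, fun x hx => ?_, fun hc => ?_, fun F ε v => rfl⟩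
    · change |(Set.projIcc l r h.le x : ℝ) - (c : Set.Icc l r).1| = _
      rw [Set.projIcc_of_mem h.le hx]
    · have hc : (c : Set.Icc l r).1 = l ∨ (c : Set.Icc l r).1 = r := hc
      exact hc.imp le_of_eq ge_of_eq
  | circle =>
    obtain ⟨s, rfl⟩ := QuotientAddGroup.mk_surjective (c : UnitAddCircle)
    -- In the window of length one centred at s, the circle distance to the centre is |x - s|.
    refine ⟨s - 1 / 2, s - 1 / 2 + 1, s, fun x hx => ?_, fun hc => absurd hc (Set.notMem_empty _),
      fun F ε v => setLIntegral_density_circle F ε v _⟩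
    change dist (x : UnitAddCircle) (s : UnitAddCircle) = _
    rw [dist_eq_norm, ← AddCircle.coe_sub, AddCircle.norm_coe_eq_abs_iff _ one_ne_zero, abs_one,
      abs_le]
    constructor <;> linarith [hx.1, hx.2]

/-- A bump depends only on the distance to its centre; it takes all its values on M only if every
small distance occurs. On an interval the point is moved towards the farther end. -/
lemma Domain.exists_dist_eq (D : Domain) : ∃ d₀ > 0, ∀ c : D.Pt, ∀ d ∈ Set.Icc 0 d₀,
    ∃ y, dist y c = d := by
  cases D with
  | interval l r h =>
    refine ⟨(r - l) / 2, by linarith, fun c d hd => ?_⟩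
    have hc := (c : Set.Icc l r).2
    rcases le_total ((c : Set.Icc l r).1) ((l + r) / 2) with hm | hm
    · refine ⟨(⟨(c : Set.Icc l r).1 + d, by linarith [hc.1, hd.1], by linarith [hd.2]⟩ :
        Set.Icc l r), ?_⟩
      change |(c : Set.Icc l r).1 + d - (c : Set.Icc l r).1| = d
      rw [add_sub_cancel_left, abs_of_nonneg hd.1]
    · refine ⟨(⟨(c : Set.Icc l r).1 - d, by linarith [hd.2], by linarith [hc.2, hd.1]⟩ :
        Set.Icc l r), ?_⟩
      change |(c : Set.Icc l r).1 - d - (c : Set.Icc l r).1| = d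
      rw [sub_sub_cancel_left, abs_neg, abs_of_nonneg hd.1]
  | circle =>
    refine ⟨1 / 2, by norm_num, fun c d hd => ?_⟩
    set c' : UnitAddCircle := c
    refine ⟨(c' + (d : UnitAddCircle) : UnitAddCircle), ?_⟩
    change dist (c' + (d : UnitAddCircle)) c' = d
    rw [dist_eq_norm, add_sub_cancel_left]
    rw [(AddCircle.norm_coe_eq_abs_iff (p := (1 : ℝ)) one_ne_zero).2, abs_of_nonneg hd.1]
    rw [abs_one, abs_of_nonneg hd.1]
    exact hd.2

lemma kappa_of_mem {D : Domain} {c : D.Pt} (h : c ∈ D.boundary) : kappa D c = 1 :=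
  Set.indicator_of_mem h _

lemma kappa_of_notMem {D : Domain} {c : D.Pt} (h : c ∉ D.boundary) : kappa D c = 0 :=
  Set.indicator_of_notMem h _

lemma kappa_le_one (D : Domain) (c : D.Pt) : kappa D c ≤ 1 := by
  by_cases h : c ∈ D.boundary
  · rw [kappa_of_mem h]
  · rw [kappa_of_notMem h]; exact zero_le_one

/-- A bump costs `G` on each side of its centre. -/
lemma setLIntegral_density_bump_le {D : Domain} {F H q : ℝ → ℝ} (hF : CondF1 F)
    (hq : IsProfile H q) (hH : Continuous H) (hH0 : ∀ y, 0 ≤ H y) {τ ε : ℝ} (hε : 0 < ε)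
    (hFH : ∀ y ∈ Set.uIcc 1 (q τ), F y ≤ H y) {c : D.Pt} {v : C(D.Pt, ℝ)}
    (hv : ∀ y, v y = bumpAt q τ ε (dist y c)) :
    ∫⁻ x in Set.Ioc D.left D.right, density D F ε v x ≤
      ENNReal.ofReal ((2 - kappa D c) * G H (q τ)) := by
  obtain ⟨A, B, s, hdist, hbd, hint⟩ := D.exists_chart c
  have hle : ∀ᵐ x ∂volume.restrict (Set.Ioc A B),
      density D F ε v x ≤ bumpDensity H q τ ε |x - s| := by
    -- The centre and the two feet are kinks of the bump; at B the chart is not a neighbourhood. A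
    -- null set may be dropped.
    have hfin : ({s, s + ε * |τ|, s - ε * |τ|, B} : Set ℝ).Finite := by simp
    filter_upwards [ae_restrict_of_ae (measure_eq_zero_iff_ae_notMem.1 (hfin.measure_zero volume)),
      ae_restrict_mem measurableSet_Ioc] with x hx hxI
    simp only [Set.mem_insert_iff, Set.mem_singleton_iff, not_or] at hx
    refine ofReal_density_bump_le hF hq hH0 hε hFH ?_ hx.1 fun habs => ?_
    · filter_upwards [Ioo_mem_nhds hxI.1 (hxI.2.lt_of_ne hx.2.2.2)] with y hy
      rw [hv, hdist y (Set.Ioo_subset_Icc_self hy)]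
    · rcases abs_eq (by positivity : 0 ≤ ε * |τ|) |>.1 habs with h | h
      · exact hx.2.1 (by linarith)
      · exact hx.2.2.1 (by linarith)
  have hG := lintegral_bumpDensity_le hq hH hH0 (τ := τ) hε
  have hr : ∫⁻ x, bumpDensity H q τ ε (x - s) ≤ ENNReal.ofReal (G H (q τ)) := by
    rwa [lintegral_sub_right_eq_self]
  have hl : ∫⁻ x, bumpDensity H q τ ε (s - x) ≤ ENNReal.ofReal (G H (q τ)) := by
    rwa [lintegral_sub_left_eq_self]
  rw [hint]
  refine (lintegral_mono_ae hle).trans ?_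
  by_cases hb : c ∈ D.boundary
  · rw [kappa_of_mem hb, show (2 - 1 : ℝ) = 1 by norm_num, one_mul]
    rcases hbd hb with h | h
    · refine le_trans ?_ ((setLIntegral_le_lintegral (Set.Ioc A B) _).trans hr)
      refine setLIntegral_mono' measurableSet_Ioc fun x hx => ?_
      rw [abs_of_pos (by linarith [hx.1])]
    · refine le_trans ?_ ((setLIntegral_le_lintegral (Set.Ioc A B) _).trans hl)
      refine setLIntegral_mono' measurableSet_Ioc fun x hx => ?_
      rw [abs_of_nonpos (by linarith [hx.2]), neg_sub]
  · rw [kappa_of_notMem hb, sub_zero, two_mul, ENNReal.ofReal_add (G_nonneg _ _) (G_nonneg _ _)]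
    refine (setLIntegral_le_lintegral _ _).trans (le_trans ?_ (add_le_add hr hl))
    rw [← lintegral_add_right']
    · refine lintegral_mono fun x => ?_
      rcases le_total x s with h | h
      · rw [abs_of_nonpos (by linarith), neg_sub]
        exact le_add_self
      · rw [abs_of_nonneg (by linarith)]
        exact le_self_add
    · have hqc : Continuous q :=
        continuous_iff_continuousAt.2 fun t => (hq.hasDerivAt t).continuousAt
      have : Measurable (bumpDensity H q τ ε) := by
        refine Measurable.indicator ?_ measurableSet_Ioo
        have : Continuous fun d => H (q (signOf τ * (|τ| - d / ε))) / ε := by fun_prop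
        exact this.measurable.ennreal_ofReal
      exact (this.comp (measurable_const.sub measurable_id)).aemeasurable

/-! ### Superposition of narrow bumps -/

/-- A sum of bumps over the constant `1`. -/
noncomputable def multiBump {D : Domain} {ι : Type*} (q : ℝ → ℝ) (ε : ℝ) (I : Finset ι)
    (c : ι → D.Pt) (τ : ι → ℝ) (y : D.Pt) : ℝ :=
  1 + ∑ k ∈ I, (bumpAt q (τ k) ε (dist y (c k)) - 1)

lemma exists_lipschitzWith_multiBump {D : Domain} {ι : Type*} {q : ℝ → ℝ} {K : NNReal}
    (hq : LipschitzWith K q) {ε : ℝ} (hε : 0 < ε) (I : Finset ι) (c : ι → D.Pt) (τ : ι → ℝ) :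
    ∃ K', LipschitzWith K' (multiBump q ε I c τ) := by
  classical
  have hb (k : ι) : LipschitzWith (K * Real.toNNReal ε⁻¹ * 1)
      fun y => bumpAt q (τ k) ε (dist y (c k)) :=
    (lipschitzWith_bumpAt hq (τ k) hε).comp (LipschitzWith.dist_left (c k))
  induction I using Finset.induction_on with
  | empty => exact ⟨0, by simp [multiBump]⟩
  | insert k I hk ih =>
    obtain ⟨K', hK'⟩ := ih
    have heq : multiBump q ε (insert k I) c τ =
        fun y => bumpAt q (τ k) ε (dist y (c k)) + -1 + multiBump q ε I c τ y := by
      funext y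
      simp only [multiBump, Finset.sum_insert hk]
      ring
    rw [heq]
    exact ⟨_, ((hb k).add (LipschitzWith.const (-1 : ℝ))).add hK'⟩

section MultiBump

variable {D : Domain} {ι : Type*} {H q : ℝ → ℝ} {ε : ℝ} {I : Finset ι} {c : ι → D.Pt} {τ : ι → ℝ}

lemma multiBump_eq_one (hq : IsProfile H q) (hε : 0 < ε) {y : D.Pt}
    (hy : ∀ j ∈ I, ε * |τ j| ≤ dist y (c j)) : multiBump q ε I c τ y = 1 := by
  rw [multiBump, Finset.sum_eq_zero, add_zero]
  intro j hj
  rw [bumpAt_of_le hq hε (hy j hj), sub_self]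

lemma multiBump_eq_bumpAt (hq : IsProfile H q) (hε : 0 < ε) {y : D.Pt} {k : ι} (hk : k ∈ I)
    (hy : ∀ j ∈ I, j ≠ k → ε * |τ j| ≤ dist y (c j)) :
    multiBump q ε I c τ y = bumpAt q (τ k) ε (dist y (c k)) := by
  rw [multiBump, Finset.sum_eq_single_of_mem k hk, add_sub_cancel]
  intro j hj hjk
  rw [bumpAt_of_le hq hε (hy j hj hjk), sub_self]

lemma lt_dist_of_separated (hsep : ∀ k ∈ I, ∀ j ∈ I, j ≠ k →
    ε * |τ k| + ε * |τ j| < dist (c k) (c j)) {y : D.Pt} {k : ι} (hk : k ∈ I)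
    (hy : dist y (c k) ≤ ε * |τ k|) : ∀ j ∈ I, j ≠ k → ε * |τ j| < dist y (c j) := by
  intro j hj hjk
  have h1 := hsep k hk j hj hjk
  have h2 := dist_triangle_left (c k) (c j) y
  linarith

/-- By strict separation, near each parameter the sum coincides with one single bump or with the
constant 1. Equality on a neighbourhood is what identifies the derivatives. -/
lemma density_multiBump_le {F : ℝ → ℝ} (hF : CondF1 F) (hq : IsProfile H q) (hε : 0 < ε)
    (hsep : ∀ k ∈ I, ∀ j ∈ I, j ≠ k → ε * |τ k| + ε * |τ j| < dist (c k) (c j))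
    {w : C(D.Pt, ℝ)} (hw : ∀ y, w y = multiBump q ε I c τ y) {u : ι → C(D.Pt, ℝ)}
    (hu : ∀ k y, u k y = bumpAt q (τ k) ε (dist y (c k))) (x : ℝ) :
    density D F ε w x ≤ ∑ k ∈ I, density D F ε (u k) x := by
  have hcont (j : ι) : ContinuousAt (fun t => dist (D.param t) (c j)) x :=
    (D.continuous_param.dist continuous_const).continuousAt
  by_cases h : ∃ k ∈ I, dist (D.param x) (c k) ≤ ε * |τ k|
  · obtain ⟨k, hk, hxk⟩ := h
    have hloc : (fun t => w (D.param t)) =ᶠ[𝓝 x] fun t => u k (D.param t) := by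
      have : ∀ᶠ t in 𝓝 x, ∀ j ∈ I, j ≠ k → ε * |τ j| < dist (D.param t) (c j) := by
        refine (eventually_all_finset I).2 fun j hj => ?_
        by_cases hjk : j = k
        · simp [hjk]
        · filter_upwards [continuousAt_const.eventually_lt (hcont j)
            (lt_dist_of_separated hsep hk hxk j hj hjk)] with t ht _ using ht
      filter_upwards [this] with t ht
      rw [hw, hu, multiBump_eq_bumpAt hq hε hk fun j hj hjk => (ht j hj hjk).le]
    refine le_trans (le_of_eq ?_)
      (Finset.single_le_sum (f := fun k => density D F ε (u k) x) (fun _ _ => zero_le) hk)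
    rw [density, density, hloc.deriv_eq, hloc.eq_of_nhds]
  · push Not at h
    have hloc : (fun t => w (D.param t)) =ᶠ[𝓝 x] fun _ => (1 : ℝ) := by
      have : ∀ᶠ t in 𝓝 x, ∀ j ∈ I, ε * |τ j| < dist (D.param t) (c j) :=
        (eventually_all_finset I).2 fun j hj =>
          continuousAt_const.eventually_lt (hcont j) (h j hj)
      filter_upwards [this] with t ht
      rw [hw, multiBump_eq_one hq hε fun j hj => (ht j hj).le]
    rw [density, hloc.deriv_eq, hloc.eq_of_nhds]
    simp [(hF.2.2 1).2 rfl]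

end MultiBump

/-- Adding a small constant to `F` inside `[-R, R]` gives a global profile at small extra cost. -/
lemma exists_isProfile_above {F : ℝ → ℝ} (hF : CondF1 F) {R : ℝ} (hR : 1 ≤ R) {η : ℝ}
    (hη : 0 < η) :
    ∃ H q, ∃ K : NNReal, Continuous H ∧ (∀ y, 0 ≤ H y) ∧ IsProfile H q ∧ LipschitzWith K q ∧
      (∀ y, |y| ≤ R → F y ≤ H y) ∧ ∀ ξ, |ξ| ≤ R → G H ξ ≤ G F ξ + η := by
  have hRR : -R ≤ R := by linarith
  -- Chosen so that √δ·|ξ - 1| ≤ η whenever |ξ| ≤ R.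
  set δ := (η / (R + 1)) ^ 2 with hδ
  have hδ0 : 0 < δ := by positivity
  -- Clamping the argument keeps H bounded, so the profile is global; adding δ removes the zero at
  -- 1, so the profile leaves 1 in finite time.
  set H : ℝ → ℝ := fun y => F (Set.projIcc (-R) R hRR y) + δ
  have hHc : Continuous H := (hF.1.comp (continuous_subtype_val.comp continuous_projIcc)).add
    continuous_const
  have hHpos (y : ℝ) : 0 < H y := add_pos_of_nonneg_of_pos (hF.2.1 _) hδ0
  obtain ⟨C, hC⟩ := (isCompact_Icc (a := -R) (b := R)).exists_bound_of_continuousOn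
    hF.1.continuousOn
  have hHC (y : ℝ) : H y ≤ C + δ := by
    have := (le_abs_self _).trans (hC _ (Set.projIcc (-R) R hRR y).2)
    simp only [H]
    linarith
  have hHeq (y : ℝ) (hy : |y| ≤ R) : H y = F y + δ := by
    simp only [H, Set.projIcc_of_mem hRR (abs_le.1 hy)]
  obtain ⟨q, hq⟩ := exists_isProfile hHc hHpos hHC
  refine ⟨H, q, _, hHc, fun y => (hHpos y).le, hq, hq.lipschitzWith hHC, fun y hy => ?_,
    fun ξ hξ => ?_⟩
  · rw [hHeq y hy]
    linarith
  · have h1 := G_le_of_perturb (ξ := ξ) hF.1 hF.2.1 hHc hδ0.le fun y hy => hHeq y (abs_le.2 ?_)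
    · rw [hδ, Real.sqrt_sq (by positivity)] at h1
      have h2 : |ξ - 1| ≤ R + 1 := (abs_sub _ _).trans (by rw [abs_one]; linarith)
      have h3 : η / (R + 1) * |ξ - 1| ≤ η / (R + 1) * (R + 1) := by gcongr
      rw [div_mul_cancel₀ _ (by positivity)] at h3
      linarith
    · have hξ' := abs_le.1 hξ
      rw [Set.mem_uIcc] at hy
      rcases hy with hy | hy <;> constructor <;> linarith [hy.1, hy.2]

/-- Functions with prescribed narrow bumps, of almost minimal energy. -/
lemma eventually_exists_bumps {D : Domain} {F : ℝ → ℝ} (hF : CondF1 F) {ι : Type*}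
    (I : Finset ι) {c : ι → D.Pt} (hc : Set.InjOn c I) (ξ : ι → ℝ) {η : ℝ} (hη : 0 < η) :
    ∀ᶠ ε in 𝓝[>] (0 : ℝ), ∃ w : C(D.Pt, ℝ), MemH1 D w ∧
      (∀ y, w y = 1 ∨ ∃ k ∈ I, dist y (c k) < η ∧ w y ∈ Set.uIcc 1 (ξ k)) ∧
      (∀ k ∈ I, ∀ z ∈ Set.uIcc 1 (ξ k), ∃ y, dist y (c k) < η ∧ w y = z) ∧
      (∀ k ∈ I, w (c k) = ξ k) ∧
      ENNReal.ofReal (energy D F ε w) ≤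
        ∑ k ∈ I, ENNReal.ofReal ((2 - kappa D (c k)) * (G F (ξ k) + η)) := by
  set R := 1 + ∑ k ∈ I, |ξ k| with hR
  have hR1 : 1 ≤ R := le_add_of_nonneg_right (Finset.sum_nonneg fun _ _ => abs_nonneg _)
  have hξR (k : ι) (hk : k ∈ I) : |ξ k| ≤ R := by
    have := Finset.single_le_sum (f := fun k => |ξ k|) (fun _ _ => abs_nonneg _) hk
    linarith
  obtain ⟨H, q, K, hHc, hH0, hq, hqL, hFH, hG⟩ := exists_isProfile_above hF hR1 hη
  choose τ hτ using fun k => hq.surjective (ξ k)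
  obtain ⟨d₀, hd₀, hdist⟩ := D.exists_dist_eq
  have hlim (A B : ℝ) (hB : 0 < B) : ∀ᶠ ε in 𝓝[>] (0 : ℝ), ε * A < B := by
    have : Tendsto (fun ε : ℝ => ε * A) (𝓝[>] 0) (𝓝 (0 * A)) :=
      ((continuous_id.mul continuous_const).tendsto 0).mono_left nhdsWithin_le_nhds
    rw [zero_mul] at this
    exact this.eventually_lt_const hB
  -- Widths below η keep the bumps near their centres; widths below d₀ ensure that each height is
  -- attained on M.
  have hsmall : ∀ᶠ ε in 𝓝[>] (0 : ℝ), ∀ k ∈ I, ε * |τ k| < min η d₀ :=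
    (eventually_all_finset I).2 fun k _ => hlim _ _ (lt_min hη hd₀)
  have hsep : ∀ᶠ ε in 𝓝[>] (0 : ℝ), ∀ k ∈ I, ∀ j ∈ I, j ≠ k →
      ε * |τ k| + ε * |τ j| < dist (c k) (c j) := by
    refine (eventually_all_finset I).2 fun k hk => (eventually_all_finset I).2 fun j hj => ?_
    by_cases hjk : j = k
    · simp [hjk]
    · filter_upwards [hlim (|τ k| + |τ j|) _
        (dist_pos.2 fun h => hjk (hc hk hj h).symm)] with ε hε _
      linarith
  filter_upwards [hsmall, hsep, self_mem_nhdsWithin] with ε hεs hεd hε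
  have hε : 0 < ε := hε
  obtain ⟨K', hK'⟩ := exists_lipschitzWith_multiBump hqL hε I c τ
  have hbc (k : ι) : Continuous fun y => bumpAt q (τ k) ε (dist y (c k)) :=
    (lipschitzWith_bumpAt hqL (τ k) hε).continuous.comp (continuous_id.dist continuous_const)
  set w : C(D.Pt, ℝ) := ⟨multiBump q ε I c τ, hK'.continuous⟩ with hw
  set u : ι → C(D.Pt, ℝ) := fun k => ⟨_, hbc k⟩
  have hwH1 : MemH1 D w := memH1_of_lipschitzWith hK'
  have hval {y : D.Pt} {k : ι} (hk : k ∈ I) (hy : dist y (c k) ≤ ε * |τ k|) :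
      w y = bumpAt q (τ k) ε (dist y (c k)) :=
    multiBump_eq_bumpAt hq hε hk fun j hj hjk => (lt_dist_of_separated hεd hk hy j hj hjk).le
  refine ⟨w, hwH1, fun y => ?_, fun k hk z hz => ?_, fun k hk => ?_, ?_⟩
  · by_cases h : ∃ k ∈ I, dist y (c k) ≤ ε * |τ k|
    · obtain ⟨k, hk, hy⟩ := h
      refine Or.inr ⟨k, hk, hy.trans_lt ((hεs k hk).trans_le (min_le_left _ _)), ?_⟩
      rw [hval hk hy, ← hτ k]
      exact bumpAt_mem_uIcc hq hε dist_nonneg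
    · push Not at h
      exact Or.inl (multiBump_eq_one hq hε fun j hj => (h j hj).le)
  · rw [← hτ k] at hz
    obtain ⟨d, hd, hdz⟩ := exists_bumpAt_eq hq hqL.continuous hε hz
    obtain ⟨y, hy⟩ := hdist (c k) d
      ⟨hd.1, hd.2.trans ((hεs k hk).le.trans (min_le_right _ _))⟩
    refine ⟨y, ?_, ?_⟩
    · rw [hy]
      exact hd.2.trans_lt ((hεs k hk).trans_le (min_le_left _ _))
    · rw [hval hk (hy.trans_le hd.2), hy, hdz]
  · rw [hval hk (by rw [dist_self]; positivity), dist_self, bumpAt_zero, hτ]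
  · rw [ofReal_energy hF hε hwH1]
    calc ∫⁻ x in Set.Ioc D.left D.right, density D F ε w x
        ≤ ∫⁻ x in Set.Ioc D.left D.right, ∑ k ∈ I, density D F ε (u k) x :=
          lintegral_mono fun x =>
            density_multiBump_le hF hq hε hεd (fun _ => rfl) (fun _ _ => rfl) x
      _ = ∑ k ∈ I, ∫⁻ x in Set.Ioc D.left D.right, density D F ε (u k) x :=
          lintegral_finsetSum _ fun k _ => measurable_density hF.1 ε (u k)
      _ ≤ _ := by
          refine Finset.sum_le_sum fun k hk => ?_
          refine (setLIntegral_density_bump_le hF hq hHc hH0 hε (fun y hy => hFH y ?_)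
            fun _ => rfl).trans (ENNReal.ofReal_le_ofReal ?_)
          · rw [hτ, Set.mem_uIcc] at hy
            have := abs_le.1 (hξR k hk)
            rw [abs_le]
            rcases hy with hy | hy <;> constructor <;> linarith [hy.1, hy.2]
          · rw [hτ]
            have := kappa_le_one D (c k)
            exact mul_le_mul_of_nonneg_left (hG _ (hξR k hk)) (by linarith)

/-! ### Placing the bumps along the limit graph -/

lemma Domain.boundary_finite (D : Domain) : D.boundary.Finite := by
  cases D with
  | interval l r h =>
    refine (Set.toFinite {(⟨l, le_rfl, h.le⟩ : Set.Icc l r), ⟨r, h.le, le_rfl⟩}).subset ?_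
    rintro x (hx | hx)
    · exact Or.inl (Subtype.ext hx)
    · exact Or.inr (Subtype.ext hx)
  | circle => exact Set.finite_empty

lemma Domain.infinite_ball (D : Domain) (x : D.Pt) {ρ : ℝ} (hρ : 0 < ρ) :
    (Metric.ball x ρ).Infinite := by
  obtain ⟨d₀, hd₀, h⟩ := D.exists_dist_eq
  have hex (d : ℝ) : ∃ y, d ∈ Set.Ioo 0 (min d₀ ρ) → dist y x = d := by
    by_cases hd : d ∈ Set.Ioo 0 (min d₀ ρ)
    · obtain ⟨y, hy⟩ := h x d ⟨hd.1.le, hd.2.le.trans (min_le_left _ _)⟩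
      exact ⟨y, fun _ => hy⟩
    · exact ⟨x, fun h => absurd h hd⟩
  choose f hf using hex
  refine Set.infinite_of_injOn_mapsTo (f := f) (s := Set.Ioo 0 (min d₀ ρ)) ?_ ?_
    (Set.Ioo_infinite (lt_min hd₀ hρ))
  · intro d hd d' hd' hdd
    rw [← hf d hd, ← hf d' hd', hdd]
  · intro d hd
    rw [Metric.mem_ball, hf d hd]
    exact hd.2.trans_le (min_le_right _ _)

/-- Finitely many points can be perturbed to distinct points off a given finite set. -/
lemma Domain.exists_injOn_near (D : Domain) (S : Finset D.Pt) {T : Set D.Pt} (hT : T.Finite)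
    {ρ : ℝ} (hρ : 0 < ρ) :
    ∃ σ : D.Pt → D.Pt, Set.InjOn σ S ∧ ∀ x ∈ S, σ x ∉ T ∧ dist (σ x) x < ρ := by
  classical
  induction S using Finset.induction_on with
  | empty => exact ⟨id, by simp, by simp⟩
  | insert x S hx ih =>
    obtain ⟨σ, hinj, hσ⟩ := ih
    obtain ⟨y, hy, hyT⟩ := (D.infinite_ball x hρ).exists_notMem_finite
      (hT.union (S.finite_toSet.image σ))
    rw [Set.mem_union, not_or] at hyT
    have hne {z : D.Pt} (hz : z ∈ S) : z ≠ x := fun h => hx (h ▸ hz)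
    refine ⟨Function.update σ x y, ?_, ?_⟩
    · rw [Finset.coe_insert, Set.injOn_insert (by simpa using hx)]
      constructor
      · intro z hz z' hz' h
        rw [Function.update_of_ne (hne hz), Function.update_of_ne (hne hz')] at h
        exact hinj hz hz' h
      · rintro ⟨z, hz, h⟩
        rw [Function.update_of_ne (hne hz), Function.update_self] at h
        exact hyT.2 ⟨z, hz, h⟩
    · intro z hz
      rcases Finset.mem_insert.1 hz with rfl | hz
      · rw [Function.update_self]
        exact ⟨hyT.1, hy⟩
      · rw [Function.update_of_ne (hne hz)]
        exact hσ z hz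

lemma jumpCost_eq_zero {D : Domain} {F : ℝ → ℝ} {Ξ : D.Pt → Set ℝ} (hΞ : Ξ ∈ classA₀ D.Pt)
    {x : D.Pt} (hx : x ∉ exceptional Ξ) : jumpCost D F Ξ x = 0 := by
  have hs : (Ξ x).Subsingleton := Set.not_nontrivial_iff.1 hx
  have h1 : Ξ x = {1} := hs.eq_singleton_of_mem (classA₀.one_mem hΞ x)
  simp [jumpCost, h1]

lemma sum_jumpCost_le_limitEnergy {D : Domain} {F : ℝ → ℝ} {Ξ : D.Pt → Set ℝ}
    (hΞ : Ξ ∈ classA₀ D.Pt) (S : Finset D.Pt) :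
    ∑ x ∈ S, ENNReal.ofReal (jumpCost D F Ξ x) ≤ limitEnergy D F Ξ := by
  rw [limitEnergy_eq hΞ, tsum_subtype_eq_of_support_subset
    (f := fun x => ENNReal.ofReal (jumpCost D F Ξ x)) (s := exceptional Ξ)]
  · exact ENNReal.sum_le_tsum S
  · intro x hx
    by_contra hcon
    exact hx (by simp [jumpCost_eq_zero hΞ hcon])

/-- The order in which the two ends of `Ξ x` are visited: the first one at `x` itself. -/
lemma exists_ends {D : Domain} {F : ℝ → ℝ} (Ξ : D.Pt → Set ℝ) (x : D.Pt) :
    ∃ p r : ℝ, (2 - kappa D x) * G F p + 2 * G F r = jumpCost D F Ξ x ∧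
      ((p = sInf (Ξ x) ∧ r = sSup (Ξ x)) ∨
        (p = sSup (Ξ x) ∧ r = sInf (Ξ x) ∧ x ∈ D.boundary)) := by
  by_cases hb : x ∈ D.boundary
  · rcases le_total (G F (sInf (Ξ x))) (G F (sSup (Ξ x))) with h | h
    · refine ⟨_, _, ?_, Or.inr ⟨rfl, rfl, hb⟩⟩
      rw [jumpCost, kappa_of_mem hb, max_eq_right h]
      ring
    · refine ⟨_, _, ?_, Or.inl ⟨rfl, rfl⟩⟩
      rw [jumpCost, kappa_of_mem hb, max_eq_left h]
      ring
  · refine ⟨_, _, ?_, Or.inl ⟨rfl, rfl⟩⟩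
    rw [jumpCost, kappa_of_notMem hb]
    ring

/-- The bumps sweep the segments from 1 to each end of Ξ x over a finite net of base points. These
segments lie in Ξ x and together fill it, which gives both halves of the Hausdorff estimate. -/
lemma eventually_exists_recovery {D : Domain} {F : ℝ → ℝ} (hF : CondF1 F) {a : D.Pt}
    (ha : a ∉ D.boundary) {Ξ : D.Pt → Set ℝ} (hΞ : Ξ ∈ classA₀ D.Pt) {η : ℝ} (hη : 0 < η) :
    ∀ᶠ ε in 𝓝[>] (0 : ℝ), ∃ w : C(D.Pt, ℝ), MemH1 D w ∧
      Metric.hausdorffEDist (graph (single w)) (graph Ξ) ≤ ENNReal.ofReal η ∧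
      w a = sInf (Ξ a) ∧
      ENNReal.ofReal (energy D F ε w) ≤ limitEnergy D F Ξ + ENNReal.ofReal η := by
  classical
  have hη4 : 0 < η / 4 := by positivity
  obtain ⟨N, hNsub, hNfin, hNcov⟩ := IsCompact.finite_cover_balls (hΞ.1.1 : IsCompact _) hη4
  -- The point a is always included, so that the value there can be prescribed exactly.
  set S : Finset D.Pt := insert a (hNfin.toFinset.image fun z => z.fst) with hS
  -- Avoiding S keeps all centres distinct; avoiding the boundary makes the second bump two-sided,
  -- in agreement with the coefficient 2 in `exists_ends`.
  obtain ⟨σ, hσinj, hσ⟩ := D.exists_injOn_near S (S.finite_toSet.union D.boundary_finite) hη4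
  choose p r hcost hends using exists_ends (F := F) Ξ
  set c : D.Pt × Bool → D.Pt := fun k => if k.2 then k.1 else σ k.1
  set ξ : D.Pt × Bool → ℝ := fun k => if k.2 then p k.1 else r k.1
  set I : Finset (D.Pt × Bool) := S ×ˢ Finset.univ
  have hI {k : D.Pt × Bool} : k ∈ I ↔ k.1 ∈ S := by simp [I]
  have hcinj : Set.InjOn c I := by
    rintro ⟨x, i⟩ hx ⟨y, j⟩ hy hxy
    have hxS : x ∈ S := hI.1 hx
    have hyS : y ∈ S := hI.1 hy
    cases i <;> cases j <;> simp only [c, if_true, if_false, Bool.false_eq_true] at hxy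
    · rw [hσinj hxS hyS hxy]
    · exact absurd (Or.inl (hxy ▸ hyS)) (hσ x hxS).1
    · exact absurd (Or.inl (hxy ▸ hxS)) (hσ y hyS).1
    · rw [hxy]
  have hcd (k : D.Pt × Bool) (hk : k ∈ I) : dist (c k) k.1 < η / 4 := by
    obtain ⟨x, i⟩ := k
    cases i
    · exact (hσ x (hI.1 hk)).2
    · simpa [c] using hη4
  have hξ (k : D.Pt × Bool) : ξ k ∈ Ξ k.1 := by
    obtain ⟨x, i⟩ := k
    obtain ⟨hIcc, h1, h2⟩ := classA₀.eq_Icc hΞ x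
    have hm : sInf (Ξ x) ∈ Ξ x := by
      rw [hIcc, csInf_Icc (h1.trans h2)]
      exact ⟨le_rfl, h1.trans h2⟩
    have hM : sSup (Ξ x) ∈ Ξ x := by
      rw [hIcc, csSup_Icc (h1.trans h2)]
      exact ⟨h1.trans h2, le_rfl⟩
    cases i <;> simp only [ξ, if_true, if_false, Bool.false_eq_true]
    · rcases hends x with h | h
      · rw [h.2]; exact hM
      · rw [h.2.1]; exact hm
    · rcases hends x with h | h
      · rw [h.1]; exact hm
      · rw [h.1]; exact hM
  have hsub (k : D.Pt × Bool) : Set.uIcc 1 (ξ k) ⊆ Ξ k.1 := by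
    have hone := classA₀.one_mem hΞ k.1
    have hk := hξ k
    rw [(classA₀.eq_Icc hΞ k.1).1] at hone hk ⊢
    exact Set.ordConnected_Icc.uIcc_subset hone hk
  -- Each base point carries two bumps with excess at most 2η' each, hence 4η' per point of S.
  set η' := η / (4 * (S.card + 1)) with hη'
  have hη'0 : 0 < η' := by positivity
  have hη'4 : η' ≤ η / 4 := by
    rw [hη']
    have : (1 : ℝ) ≤ S.card + 1 := by simp
    exact div_le_div_of_nonneg_left hη.le (by norm_num) (by linarith)
  filter_upwards [eventually_exists_bumps hF I hcinj ξ hη'0] with ε ⟨w, hw, hnear, hatt, hctr, hE⟩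
  have haS : a ∈ S := Finset.mem_insert_self _ _
  refine ⟨w, hw, ?_, ?_, ?_⟩
  · refine Metric.hausdorffEDist_le_of_mem_edist ?_ ?_
    · intro z hz
      have hz : z.snd = w z.fst := hz
      rcases hnear z.fst with h | ⟨k, hk, hd, hm⟩
      · refine ⟨z, ?_, by simp⟩
        change z.snd ∈ Ξ z.fst
        rw [hz, h]
        exact classA₀.one_mem hΞ _
      · refine ⟨WithLp.toLp 2 (k.1, w z.fst), hsub k hm, ?_⟩
        rw [edist_dist]
        apply ENNReal.ofReal_le_ofReal
        refine (dist_le_add_of_withLp _ _).trans ?_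
        simp only [WithLp.toLp_fst, WithLp.toLp_snd, hz, dist_self, add_zero]
        have h1 := dist_triangle z.fst (c k) k.1
        have h2 := hcd k hk
        linarith
    · intro z hz
      obtain ⟨n, hnN, hzn⟩ := Set.mem_iUnion₂.1 (hNcov hz)
      have hnS : n.fst ∈ S := Finset.mem_insert_of_mem
        (Finset.mem_image.2 ⟨n, hNfin.mem_toFinset.2 hnN, rfl⟩)
      have hn : n.snd ∈ Ξ n.fst := hNsub hnN
      obtain ⟨k, hk1, hkn⟩ : ∃ k : D.Pt × Bool, k.1 = n.fst ∧ n.snd ∈ Set.uIcc 1 (ξ k) := by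
        obtain ⟨hIcc, -, -⟩ := classA₀.eq_Icc hΞ n.fst
        rw [hIcc] at hn
        have hlow (hle : n.snd ≤ 1) : n.snd ∈ Set.uIcc 1 (sInf (Ξ n.fst)) :=
          Set.mem_uIcc.2 (Or.inr ⟨hn.1, hle⟩)
        have hhigh (hle : 1 ≤ n.snd) : n.snd ∈ Set.uIcc 1 (sSup (Ξ n.fst)) :=
          Set.mem_uIcc.2 (Or.inl ⟨hle, hn.2⟩)
        rcases le_total n.snd 1 with hle | hle <;> rcases hends n.fst with h | h
        · exact ⟨(n.fst, true), rfl, by simpa [ξ, h.1] using hlow hle⟩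
        · exact ⟨(n.fst, false), rfl, by simpa [ξ, h.2.1] using hlow hle⟩
        · exact ⟨(n.fst, false), rfl, by simpa [ξ, h.2] using hhigh hle⟩
        · exact ⟨(n.fst, true), rfl, by simpa [ξ, h.1] using hhigh hle⟩
      have hkI : k ∈ I := hI.2 (hk1 ▸ hnS)
      obtain ⟨y, hy, hyw⟩ := hatt k hkI _ hkn
      refine ⟨WithLp.toLp 2 (y, w y), rfl, ?_⟩
      rw [edist_dist]
      apply ENNReal.ofReal_le_ofReal
      have h1 := dist_triangle z n (WithLp.toLp 2 (y, w y))
      have h2 := dist_le_add_of_withLp n (WithLp.toLp 2 (y, w y))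
      simp only [WithLp.toLp_fst, WithLp.toLp_snd, hyw, dist_self, add_zero] at h2
      have h3 := dist_triangle_left n.fst y (c k)
      have h4 := hcd k hkI
      rw [hk1] at h4
      rw [dist_comm (c k) y] at h3
      rw [hyw] at h1 ⊢
      have h5 : dist z n < η / 4 := hzn
      linarith
  · have h1 := hctr (a, true) (hI.2 haS)
    have h2 : p a = sInf (Ξ a) := by
      rcases hends a with h | h
      · exact h.1
      · exact absurd h.2.2 ha
    simpa [c, ξ, h2] using h1
  · refine hE.trans ?_
    have hterm (x : D.Pt) (hx : x ∈ S) :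
        ∑ i : Bool, ENNReal.ofReal ((2 - kappa D (c (x, i))) * (G F (ξ (x, i)) + η')) ≤
          ENNReal.ofReal (jumpCost D F Ξ x) + ENNReal.ofReal (4 * η') := by
      have hκ : kappa D (σ x) = 0 := kappa_of_notMem fun h => (hσ x hx).1 (Or.inr h)
      have hκ1 := kappa_le_one D x
      have hκ0 : 0 ≤ kappa D x := Set.indicator_nonneg (fun _ _ => zero_le_one) _
      have hGp := G_nonneg F (p x)
      have hGr := G_nonneg F (r x)
      rw [Fintype.sum_bool]
      simp only [c, ξ, if_true, if_false, Bool.false_eq_true, hκ, sub_zero]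
      have hnn : 0 ≤ (2 - kappa D x) * G F (p x) := mul_nonneg (by linarith) hGp
      rw [← ENNReal.ofReal_add (mul_nonneg (by linarith) (by positivity)) (by positivity),
        ← ENNReal.ofReal_add (by rw [← hcost x]; positivity) (by positivity)]
      apply ENNReal.ofReal_le_ofReal
      rw [← hcost x]
      nlinarith
    calc ∑ k ∈ I, ENNReal.ofReal ((2 - kappa D (c k)) * (G F (ξ k) + η'))
        = ∑ x ∈ S, ∑ i : Bool,
            ENNReal.ofReal ((2 - kappa D (c (x, i))) * (G F (ξ (x, i)) + η')) :=
          Finset.sum_product _ _ _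
      _ ≤ ∑ x ∈ S, (ENNReal.ofReal (jumpCost D F Ξ x) + ENNReal.ofReal (4 * η')) :=
          Finset.sum_le_sum hterm
      _ = ∑ x ∈ S, ENNReal.ofReal (jumpCost D F Ξ x) + ENNReal.ofReal (S.card * (4 * η')) := by
          rw [Finset.sum_add_distrib, Finset.sum_const, nsmul_eq_mul,
            ENNReal.ofReal_mul (Nat.cast_nonneg _), ENNReal.ofReal_natCast]
      _ ≤ limitEnergy D F Ξ + ENNReal.ofReal η := by
          refine add_le_add (sum_jumpCost_le_limitEnergy hΞ S) (ENNReal.ofReal_le_ofReal ?_)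
          have : (S.card + 1) * (4 * η') = η := by rw [hη']; field_simp
          linarith

/-! ### The diagonal family and its limit -/

/-- A diagonal choice: approximations of every accuracy give one approximating family. -/
lemma exists_diagonal {α : Type*} [Nonempty α] (P : ℝ → ℝ → α → Prop)
    (hmono : ∀ ε w η η', η ≤ η' → P η ε w → P η' ε w)
    (h : ∀ η > 0, ∀ᶠ ε in 𝓝[>] (0 : ℝ), ∃ w, P η ε w) :
    ∃ w : ℝ → α, ∀ η > 0, ∀ᶠ ε in 𝓝[>] (0 : ℝ), P η ε (w ε) := by
  classical
  -- N ε indexes the best accuracy 1/(n + 1) attainable at ε. The cap ⌊1/ε⌋ makes a greatest index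
  -- exist and tends to infinity, so every fixed accuracy is eventually allowed.
  set N : ℝ → ℕ := fun ε =>
    Nat.findGreatest (fun n => ∃ w, P (1 / ((n : ℝ) + 1)) ε w) ⌊1 / ε⌋₊ with hN
  have hex (ε : ℝ) : ∃ w, (∃ w, P (1 / ((N ε : ℝ) + 1)) ε w) → P (1 / ((N ε : ℝ) + 1)) ε w := by
    by_cases hw : ∃ w, P (1 / ((N ε : ℝ) + 1)) ε w
    · exact ⟨hw.choose, fun _ => hw.choose_spec⟩
    · exact ⟨Classical.arbitrary α, fun h => absurd h hw⟩
  choose w hw using hex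
  refine ⟨w, fun η hη => ?_⟩
  obtain ⟨n, hn⟩ := exists_nat_one_div_lt hη
  have hlarge : ∀ᶠ ε in 𝓝[>] (0 : ℝ), n ≤ ⌊1 / ε⌋₊ := by
    filter_upwards [tendsto_inv_nhdsGT_zero.eventually_ge_atTop (n : ℝ)] with ε hε
    rw [one_div]
    exact Nat.le_floor hε
  filter_upwards [h (1 / ((n : ℝ) + 1)) (by positivity), hlarge] with ε h1 h2
  have h3 : n ≤ N ε := Nat.le_findGreatest h2 h1
  have h4 : ∃ w, P (1 / ((N ε : ℝ) + 1)) ε w :=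
    Nat.findGreatest_spec (P := fun n : ℕ => ∃ w, P (1 / ((n : ℝ) + 1)) ε w) h2 h1
  refine hmono _ _ _ _ (le_trans ?_ hn.le) (hw ε h4)
  gcongr

lemma exists_recovery {D : Domain} {F : ℝ → ℝ} (hF : CondF1 F) {a : D.Pt}
    (ha : a ∉ D.boundary) {b : ℝ} (hb : 0 ≤ b) {Ξ : D.Pt → Set ℝ} (hΞ : Ξ ∈ classA₀ D.Pt) :
    ∃ w : ℝ → C(D.Pt, ℝ),
      (∀ ε ∈ Set.Ioo (0 : ℝ) 1, MemH1 D (w ε)) ∧ GraphTendsto w Ξ ∧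
        Tendsto (fun ε => ENNReal.ofReal (energyB D F a b ε (w ε))) (𝓝[>] 0)
          (𝓝 (limitEnergyB D F a b Ξ)) := by
  have : Nonempty {w : C(D.Pt, ℝ) // MemH1 D w} :=
    ⟨ContinuousMap.const _ 1, memH1_of_lipschitzWith (K := 0) (LipschitzWith.const (1 : ℝ))⟩
  obtain ⟨w, hw⟩ := exists_diagonal (α := {w : C(D.Pt, ℝ) // MemH1 D w})
    (fun η ε w =>
      Metric.hausdorffEDist (graph (single w.1)) (graph Ξ) ≤ ENNReal.ofReal η ∧
      w.1 a = sInf (Ξ a) ∧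
      ENNReal.ofReal (energy D F ε w.1) ≤ limitEnergy D F Ξ + ENNReal.ofReal η)
    (fun ε w η η' hle h => ⟨h.1.trans (ENNReal.ofReal_le_ofReal hle), h.2.1,
      h.2.2.trans (add_le_add le_rfl (ENNReal.ofReal_le_ofReal hle))⟩)
    (fun η hη => (eventually_exists_recovery hF ha hΞ hη).mono
      fun ε ⟨w, hw, h⟩ => ⟨⟨w, hw⟩, h⟩)
  have hmem : ∀ ε ∈ Set.Ioo (0 : ℝ) 1, MemH1 D (w ε).1 := fun ε _ => (w ε).2
  have hgraph : GraphTendsto (fun ε => (w ε).1) Ξ := by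
    rw [GraphTendsto, ENNReal.tendsto_nhds_zero]
    intro η hη
    obtain ⟨r, hr, hrη⟩ := exists_ofReal_le hη
    exact (hw r hr).mono fun ε h => h.1.trans hrη
  refine ⟨fun ε => (w ε).1, hmem, hgraph, ?_⟩
  have hE : Tendsto (fun ε => ENNReal.ofReal (energy D F ε (w ε).1)) (𝓝[>] 0)
      (𝓝 (limitEnergy D F Ξ)) := by
    refine tendsto_of_le_liminf_of_limsup_le ?_ ?_
    -- Using b = 0 avoids any sign condition on Ξ(a); the remaining term is exact because the family
    -- takes the value min Ξ(a) at a.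
    · have := limitEnergyB_le_liminf hF (a := a) le_rfl hmem hΞ.1.1 hgraph (Or.inl rfl)
      simpa [limitEnergyB, energyB] using this
    · refine ENNReal.le_of_forall_pos_le_add fun η hη _ => ?_
      refine limsup_le_of_le (by isBoundedDefault) ((hw η hη).mono fun ε h => ?_)
      simpa using h.2.2
  refine (hE.add (tendsto_const_nhds (x := ENNReal.ofReal (b * sInf (Ξ a) ^ 2)))).congr' ?_
  filter_upwards [hw 1 one_pos, self_mem_nhdsWithin] with ε h hε
  rw [energyB, ENNReal.ofReal_add (energy_nonneg hF hε _) (by positivity), h.2.1]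

end SMM

open SMM Filter Topology in
theorem theorem2p1 (D : Domain) (F : ℝ → ℝ) (hF1 : CondF1 F) (hF2 : CondF2 F)
    (a : D.Pt) (ha : a ∉ D.boundary) (b : ℝ) (hb : 0 ≤ b) :
    -- liminf inequality, and the limit lies in `𝓐₀` if the liminf is finite
    (∀ (v : ℝ → C(D.Pt, ℝ)) (Ξ : D.Pt → Set ℝ),
      (∀ ε ∈ Set.Ioo (0 : ℝ) 1, MemH1 D (v ε)) → Ξ ∈ classB D.Pt → GraphTendsto v Ξ →
        ((b = 0 ∨ 0 ≤ sInf (Ξ a)) →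
          limitEnergyB D F a b Ξ ≤
            liminf (fun ε => ENNReal.ofReal (energyB D F a b ε (v ε))) (𝓝[>] 0)) ∧
        (liminf (fun ε => ENNReal.ofReal (energyB D F a b ε (v ε))) (𝓝[>] 0) < ⊤ →
          Ξ ∈ classA₀ D.Pt)) ∧
    -- existence of recovery families
    (∀ Ξ ∈ classA₀ D.Pt, ∃ w : ℝ → C(D.Pt, ℝ),
      (∀ ε ∈ Set.Ioo (0 : ℝ) 1, MemH1 D (w ε)) ∧ GraphTendsto w Ξ ∧
        Tendsto (fun ε => ENNReal.ofReal (energyB D F a b ε (w ε))) (𝓝[>] 0)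
          (𝓝 (limitEnergyB D F a b Ξ))) :=
  ⟨fun _ _ hv hΞ h => ⟨limitEnergyB_le_liminf hF1 hb hv hΞ h,
      mem_classA₀_of_liminf_lt_top hF1 hb hv hΞ h⟩,
    fun _ hΞ => exists_recovery hF1 ha hb hΞ⟩
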